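/- **Corollary (sufficient condition for stable oscillations).** Let $\mathcal L:\mathbb R^d\to\mathbb R$ and let $x^*$ be a local minimizer of $\mathcal L$ at which $\mathcal L$ is four times differentiable (the derivatives up to order three exist in a neighbourhood of $x^*$ and the third derivative is differentiable at $x^*$). Assume that the Hessian $\nabla^2\mathcal L(x^*)$ is positive definite and that its largest eigenvalue $\lambda_{\max}$ has multiplicity one; let $v_{\max}\neq 0$ be an eigenvector for $\lambda_{\max}$, and let $\eta_{\mathrm c}$ be the edge-of-stability step size, $\lambda_{\max}=2/\eta_{\mathrm c}$. Write $D^k\mathcal L(x^*)[v]^k$ for the $k$-th derivative, as a $k$-linear form, applied $k$ times to $v$. We say that *gradient descent has a stable period-2 cycle in the vicinity of $x^*$* if for every neighbourhood $U$ of $x^*$ there is $\delta>0$ such that for every step size $\eta\in(\eta_{\mathrm c},\eta_{\mathrm c}+\delta)$ the map $\psi_\eta(x)=x-\eta\nabla\mathcal L(x)$ has points $x^{(1)}\ne x^{(2)}$ in $U$ with $\psi_\eta(x^{(1)})=x^{(2)}$ and $\psi_\eta(x^{(2)})=x^{(1)}$, and this cycle is asymptotically stable (for $i=1,2$, orbits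 started close enough to $x^{(i)}$ stay close to the orbit of $x^{(i)}$ and converge to it). 1. If $$3\,\frac{\big(D^3\mathcal L(x^*)[v_{\max}]^3\big)^2}{D^2\mathcal L(x^*)[v_{\max}]^2}>D^4\mathcal L(x^*)[v_{\max}]^4\qquad(\ast)$$ or $D^4\mathcal L(x^*)[v_{\max}]^4<0$, then gradient descent has a stable period-2 cycle in the vicinity of $x^*$. 2. Condition $(\ast)$ is not necessary: there are $d$, $\mathcal L$, $x^*$ and $v_{\max}$ satisfying all the assumptions above such that gradient descent has a stable period-2 cycle in the vicinity of $x^*$ although $(\ast)$ fails. -/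

import Mathlib

open Filter Topology

noncomputable section

/-- `f` is `n` times differentiable at the point `x`: the derivatives of order `< n - 1` are
differentiable in a neighbourhood of `x` and the derivative of order `n - 1` is differentiable at
`x` (continuity of the `n`-th derivative is not required, nor is its existence away from `x`). -/
def TimesDifferentiableAt {E : Type*} [NormedAddCommGroup E] [NormedSpace ℝ E]
    (n : ℕ) (f : E → ℝ) (x : E) : Prop :=
  (∀ k : ℕ, k + 1 < n → ∀ᶠ y in 𝓝 x, DifferentiableAt ℝ (iteratedFDeriv ℝ k f) y) ∧
    ∀ k : ℕ, k < n → DifferentiableAt ℝ (iteratedFDeriv ℝ k f) x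

/-- The `k`-th derivative of `f` at `x` as a `k`-linear form, applied `k` times to `v`. -/
def derivForm {E : Type*} [NormedAddCommGroup E] [NormedSpace ℝ E]
    (k : ℕ) (f : E → ℝ) (x v : E) : ℝ :=
  iteratedFDeriv ℝ k f x (fun _ => v)

/-- The Hessian operator: the derivative of the gradient. -/
def hessian {d : ℕ} (L : EuclideanSpace ℝ (Fin d) → ℝ) (x : EuclideanSpace ℝ (Fin d)) :
    EuclideanSpace ℝ (Fin d) →L[ℝ] EuclideanSpace ℝ (Fin d) :=
  fderiv ℝ (gradient L) x

/-- One step of gradient descent on `L` with step size `η`. -/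
def gdStep {d : ℕ} (L : EuclideanSpace ℝ (Fin d) → ℝ) (η : ℝ) (x : EuclideanSpace ℝ (Fin d)) :
    EuclideanSpace ℝ (Fin d) :=
  x - η • gradient L x

/-- The orbit of `p` under `f` is asymptotically stable: orbits starting close to `p` stay close to
the orbit of `p` and converge to it. -/
def IsAsymptoticallyStableOrbit {E : Type*} [MetricSpace E] (f : E → E) (p : E) : Prop :=
  (∀ ε > 0, ∃ δ > 0, ∀ x, dist x p < δ → ∀ n : ℕ, dist (f^[n] x) (f^[n] p) < ε) ∧
    ∃ δ > 0, ∀ x, dist x p < δ → Tendsto (fun n : ℕ => dist (f^[n] x) (f^[n] p)) atTop (𝓝 0)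

/-- `p, q` is an asymptotically stable cycle of (exact) period two of the map `f`. -/
structure IsStableTwoCycle {E : Type*} [MetricSpace E] (f : E → E) (p q : E) : Prop where
  ne : p ≠ q
  map_left : f p = q
  map_right : f q = p
  stable_left : IsAsymptoticallyStableOrbit f p
  stable_right : IsAsymptoticallyStableOrbit f q

/-- A stable period-2 cycle of gradient descent emerges at `x` as the step size exceeds `ηc`:
in each neighbourhood of `x`, gradient descent has a stable period-2 cycle for all step sizes
slightly above `ηc`. -/
def HasStableTwoCycleNear {d : ℕ} (L : EuclideanSpace ℝ (Fin d) → ℝ)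
    (x : EuclideanSpace ℝ (Fin d)) (ηc : ℝ) : Prop :=
  ∀ U ∈ 𝓝 x, ∀ᶠ η in 𝓝[>] ηc, ∃ p ∈ U, ∃ q ∈ U, IsStableTwoCycle (gdStep L η) p q

/-- The setting: `x` is a local minimizer of `L` with positive definite Hessian, `v` is an
eigenvector of the largest Hessian eigenvalue `lam`, which is simple, and `ηc` is the
edge-of-stability step size. -/
structure EdgeOfStability {d : ℕ} (L : EuclideanSpace ℝ (Fin d) → ℝ)
    (x v : EuclideanSpace ℝ (Fin d)) (lam ηc : ℝ) : Prop where
  isLocalMin : IsLocalMin L x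
  differentiable : TimesDifferentiableAt 4 L x
  hessian_pos : ∀ w : EuclideanSpace ℝ (Fin d), w ≠ 0 → 0 < inner ℝ w (hessian L x w)
  eigenvector : Module.End.HasEigenvector (hessian L x).toLinearMap lam v
  eigenvalue_max : ∀ μ : ℝ, Module.End.HasEigenvalue (hessian L x).toLinearMap μ → μ ≤ lam
  simple : Module.finrank ℝ (Module.End.eigenspace (hessian L x).toLinearMap lam) = 1
  edge : lam = 2 / ηc

/-- The condition `3 (D³L(x)[v]³)² / D²L(x)[v]² > D⁴L(x)[v]⁴` along the direction `v`. -/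
def SharpDirectionCondition {d : ℕ} (L : EuclideanSpace ℝ (Fin d) → ℝ)
    (x v : EuclideanSpace ℝ (Fin d)) : Prop :=
  3 * (derivForm 3 L x v ^ 2 / derivForm 2 L x v) > derivForm 4 L x v

end

/-!
Along the simple leading eigenvector `v` of the Hessian, the multiplier of the gradient step at the
minimizer crosses `-1` at the step size `2 / lam`, while all other multipliers stay inside the unit
disc: a flip bifurcation. It produces an attracting two-cycle when the second iterate on the center
manifold has a negative cubic coefficient, and this coefficient is a negative multiple of
`3 ⟪T v v, H⁻¹ (T v v)⟫ - D⁴L[v]⁴`, with `H` the Hessian and `T` the third derivative.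
By Cauchy–Schwarz for the scalar product of `H`, the first term is at least
`3 (D³L[v]³)² / D²L[v]²`, so the condition in the direction `v` suffices
(`EdgeOfStability.hasStableTwoCycleNear_of_sharpDirectionCondition`), and a negative `D⁴L[v]⁴` is a
special case of it. It is not necessary, because `T v v` need not be parallel to `v`: for
`y₀² + y₀² y₁ + y₁² / 2` the condition reads `0 > 0`, but `⟪T v v, H⁻¹ (T v v)⟫ = 4`.

The proof avoids center manifold theory. For a step size `η` with `η lam = 2 + k s²`, the
coordinates `x + s a v + s² w`, `w ⊥ v`, turn the second iterate of the gradient step into a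
slow–fast map: `a` moves by `O(s²)`, whereas `w` is contracted at a fixed rate towards a parabola
over `a`. After a linear change of variables straightening the tangent of this parabola, and with a
small weight on the transversal coordinate, this map contracts a small box
(`exists_stable_fixedPoint_of_slowFast`), which yields the cycle and its stability in one stroke.

Since the objective is only four times differentiable at one point, the convergence of the rescaled
maps as `s → 0` is expressed by difference quotients, uniformly near a point
(`HasStrictFDerivAlong`); this notion has a chain rule, and it is all that a contraction argument
requires. It holds because the third-order Taylor remainder of the gradient is Lipschitz with
constant `o(r²)` on balls of radius `r` (`norm_taylorRemainder_sub_le`).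
-/

/-! ### Strict derivatives that hold uniformly along a family of maps -/

section StrictFamilies

open Asymptotics

variable {ι X Y Z : Type*} [NormedAddCommGroup X] [NormedSpace ℝ X]
  [NormedAddCommGroup Y] [NormedSpace ℝ Y] [NormedAddCommGroup Z] [NormedSpace ℝ Z]
  {l : Filter ι} {f : ι → X → Y} {f' : X →L[ℝ] Y} {x₀ : X} {y₀ : Y}

/-- The maps `f s` have, in the limit along `l`, the value `y₀` and the strict derivative `f'` at
`x₀`: for every `ε` there is one neighbourhood of `x₀` on which, eventually in `s`, the map
`f s - f'` is `ε`-Lipschitz. No single `f s` needs to be differentiable. -/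
def HasStrictFDerivAlong (l : Filter ι) (f : ι → X → Y) (f' : X →L[ℝ] Y) (x₀ : X) (y₀ : Y) :
    Prop :=
  Tendsto (fun s => f s x₀) l (𝓝 y₀) ∧
    (fun p : ι × X × X => f p.1 p.2.1 - f p.1 p.2.2 - f' (p.2.1 - p.2.2))
      =o[l ×ˢ 𝓝 (x₀, x₀)] fun p => p.2.1 - p.2.2

namespace HasStrictFDerivAlong

theorem of_strict {g : X → Y} (hg : HasStrictFDerivAt g f' x₀) :
    HasStrictFDerivAlong l (fun _ => g) f' x₀ (g x₀) :=
  ⟨tendsto_const_nhds, hg.isLittleO.comp_tendsto tendsto_snd⟩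

theorem of_tendsto {c : ι → Y} (hc : Tendsto c l (𝓝 y₀)) :
    HasStrictFDerivAlong l (fun s (_ : X) => c s) 0 x₀ y₀ :=
  ⟨hc, by simp⟩

theorem isBigO (hf : HasStrictFDerivAlong l f f' x₀ y₀) :
    (fun p : ι × X × X => f p.1 p.2.1 - f p.1 p.2.2)
      =O[l ×ˢ 𝓝 (x₀, x₀)] fun p => p.2.1 - p.2.2 := by
  have h := hf.2.isBigO.add (f'.isBigO_comp (fun p : ι × X × X => p.2.1 - p.2.2)
    (l ×ˢ 𝓝 (x₀, x₀)))
  simpa using h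

theorem tendsto (hf : HasStrictFDerivAlong l f f' x₀ y₀) :
    Tendsto (fun p : ι × X => f p.1 p.2) (l ×ˢ 𝓝 x₀) (𝓝 y₀) := by
  have h1 : Tendsto (fun p : ι × X => (p.1, p.2, x₀)) (l ×ˢ 𝓝 x₀) (l ×ˢ 𝓝 (x₀, x₀)) := by
    rw [nhds_prod_eq]
    exact tendsto_fst.prodMk (tendsto_snd.prodMk tendsto_const_nhds)
  have h2 := hf.isBigO.comp_tendsto h1
  have h3 : Tendsto (fun p : ι × X => p.2 - x₀) (l ×ˢ 𝓝 x₀) (𝓝 0) := by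
    have : Tendsto (fun p : ι × X => p.2 - x₀) (l ×ˢ 𝓝 x₀) (𝓝 (x₀ - x₀)) :=
      tendsto_snd.sub tendsto_const_nhds
    simpa using this
  have h4 := h2.trans_tendsto h3
  have h5 := h4.add (hf.1.comp (tendsto_fst (f := l) (g := 𝓝 x₀)))
  simpa [Function.comp_def] using h5

theorem comp {g : ι → Y → Z} {g' : Y →L[ℝ] Z} {z₀ : Z}
    (hg : HasStrictFDerivAlong l g g' y₀ z₀) (hf : HasStrictFDerivAlong l f f' x₀ y₀) :
    HasStrictFDerivAlong l (fun s x => g s (f s x)) (g'.comp f') x₀ z₀ := by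
  refine ⟨hg.tendsto.comp (tendsto_id.prodMk hf.1), ?_⟩
  have h1 : Tendsto (fun p : ι × X × X => (p.1, f p.1 p.2.1, f p.1 p.2.2)) (l ×ˢ 𝓝 (x₀, x₀))
      (l ×ˢ 𝓝 (y₀, y₀)) := by
    simp only [nhds_prod_eq]
    refine tendsto_fst.prodMk (Tendsto.prodMk ?_ ?_)
    · exact hf.tendsto.comp (tendsto_fst.prodMk (tendsto_fst.comp tendsto_snd))
    · exact hf.tendsto.comp (tendsto_fst.prodMk (tendsto_snd.comp tendsto_snd))
  have h2 := (hg.2.comp_tendsto h1).trans_isBigO hf.isBigO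
  have h3 := (g'.isBigO_comp _ _).trans_isLittleO hf.2
  refine (h2.add h3).congr_left fun p => ?_
  simp [map_sub]

theorem prodMk {g : ι → X → Z} {g' : X →L[ℝ] Z} {z₀ : Z}
    (hf : HasStrictFDerivAlong l f f' x₀ y₀) (hg : HasStrictFDerivAlong l g g' x₀ z₀) :
    HasStrictFDerivAlong l (fun s x => (f s x, g s x)) (f'.prod g') x₀ (y₀, z₀) :=
  ⟨hf.1.prodMk_nhds hg.1, (hf.2.prod_left hg.2).congr_left fun p => by simp⟩

theorem congr' {g : ι → X → Y} (hf : HasStrictFDerivAlong l f f' x₀ y₀)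
    (h : ∀ᶠ s in l, ∀ x, f s x = g s x) : HasStrictFDerivAlong l g f' x₀ y₀ := by
  refine ⟨hf.1.congr' (h.mono fun s hs => hs x₀), hf.2.congr' ?_ EventuallyEq.rfl⟩
  filter_upwards [h.prod_inl (𝓝 (x₀, x₀))] with p hp
  rw [hp, hp]

theorem congr_deriv {g' : X →L[ℝ] Y} {z₀ : Y} (hf : HasStrictFDerivAlong l f f' x₀ y₀)
    (h : ∀ x, f' x = g' x) (hz : y₀ = z₀) : HasStrictFDerivAlong l f g' x₀ z₀ := by
  obtain rfl : f' = g' := ContinuousLinearMap.ext h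
  exact hz ▸ hf

theorem comp_strict {g : Y → Z} {g' : Y →L[ℝ] Z}
    (hg : HasStrictFDerivAt g g' y₀) (hf : HasStrictFDerivAlong l f f' x₀ y₀) :
    HasStrictFDerivAlong l (fun s x => g (f s x)) (g'.comp f') x₀ (g y₀) :=
  (of_strict hg).comp hf

theorem clm (A : Y →L[ℝ] Z) (hf : HasStrictFDerivAlong l f f' x₀ y₀) :
    HasStrictFDerivAlong l (fun s x => A (f s x)) (A.comp f') x₀ (A y₀) :=
  comp_strict A.hasStrictFDerivAt hf

theorem add {g : ι → X → Y} {g' : X →L[ℝ] Y} {z₀ : Y}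
    (hf : HasStrictFDerivAlong l f f' x₀ y₀) (hg : HasStrictFDerivAlong l g g' x₀ z₀) :
    HasStrictFDerivAlong l (fun s x => f s x + g s x) (f' + g') x₀ (y₀ + z₀) :=
  (clm (ContinuousLinearMap.fst ℝ Y Y + ContinuousLinearMap.snd ℝ Y Y) (hf.prodMk hg)).congr_deriv
    (fun x => by simp) (by simp)

theorem sub {g : ι → X → Y} {g' : X →L[ℝ] Y} {z₀ : Y}
    (hf : HasStrictFDerivAlong l f f' x₀ y₀) (hg : HasStrictFDerivAlong l g g' x₀ z₀) :
    HasStrictFDerivAlong l (fun s x => f s x - g s x) (f' - g') x₀ (y₀ - z₀) :=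
  (clm (ContinuousLinearMap.fst ℝ Y Y - ContinuousLinearMap.snd ℝ Y Y) (hf.prodMk hg)).congr_deriv
    (fun x => by simp) (by simp)

theorem smul {c : ι → X → ℝ} {c' : X →L[ℝ] ℝ} {c₀ : ℝ}
    (hc : HasStrictFDerivAlong l c c' x₀ c₀) (hf : HasStrictFDerivAlong l f f' x₀ y₀) :
    HasStrictFDerivAlong l (fun s x => c s x • f s x) (c₀ • f' + c'.smulRight y₀) x₀ (c₀ • y₀) := by
  have h : HasStrictFDerivAt (fun p : ℝ × Y => p.1 • p.2)
      (c₀ • ContinuousLinearMap.snd ℝ ℝ Y + (ContinuousLinearMap.fst ℝ ℝ Y).smulRight y₀)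
      (c₀, y₀) :=
    HasStrictFDerivAt.smul (x := ((c₀, y₀) : ℝ × Y)) (c := Prod.fst) (f := Prod.snd)
      hasStrictFDerivAt_fst hasStrictFDerivAt_snd
  exact (comp_strict h (hc.prodMk hf)).congr_deriv (fun x => by simp) rfl

/-- Multiplication by scalars that converge along the family. -/
theorem tendsto_smul {c : ι → ℝ} {c₀ : ℝ} (hc : Tendsto c l (𝓝 c₀))
    (hf : HasStrictFDerivAlong l f f' x₀ y₀) :
    HasStrictFDerivAlong l (fun s x => c s • f s x) (c₀ • f') x₀ (c₀ • y₀) :=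
  ((of_tendsto hc).smul hf).congr_deriv (fun x => by simp) rfl

theorem exists_closedBall (hf : HasStrictFDerivAlong l f f' x₀ y₀) {ε : ℝ} (hε : 0 < ε) :
    ∃ ρ > 0, ∀ᶠ s in l, ∀ x ∈ Metric.closedBall x₀ ρ, ∀ y ∈ Metric.closedBall x₀ ρ,
      ‖f s x - f s y - f' (x - y)‖ ≤ ε * ‖x - y‖ := by
  have h := hf.2.def hε
  obtain ⟨pa, ha, pb, hb, hab⟩ := eventually_prod_iff.1 h
  obtain ⟨ρ, hρ, hsub⟩ := Metric.nhds_basis_closedBall.eventually_iff.1 hb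
  refine ⟨ρ, hρ, ha.mono fun s hs x hx y hy => ?_⟩
  have : (x, y) ∈ Metric.closedBall (x₀, x₀) ρ := by
    rw [← closedBall_prod_same]; exact ⟨hx, hy⟩
  exact hab hs (hsub this)

end HasStrictFDerivAlong

end StrictFamilies

/-! ### Asymptotic stability of fixed points and of two-cycles -/

section Stability

variable {E E' : Type*} [MetricSpace E] [MetricSpace E']

theorem isAsymptoticallyStableOrbit_iff_of_fixed {f : E → E} {p : E} (hp : f p = p) :
    IsAsymptoticallyStableOrbit f p ↔
      (∀ U ∈ 𝓝 p, ∀ᶠ x in 𝓝 p, ∀ n : ℕ, f^[n] x ∈ U) ∧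
        ∀ᶠ x in 𝓝 p, Tendsto (fun n : ℕ => f^[n] x) atTop (𝓝 p) := by
  have hn : ∀ n : ℕ, f^[n] p = p := fun n => Function.iterate_fixed hp n
  simp only [IsAsymptoticallyStableOrbit, hn, Metric.eventually_nhds_iff,
    ← tendsto_iff_dist_tendsto_zero]
  refine and_congr_left fun _ => ⟨fun h U hU => ?_, fun h ε hε => ?_⟩
  · obtain ⟨ε, hε, hU⟩ := Metric.mem_nhds_iff.1 hU
    obtain ⟨δ, hδ, H⟩ := h ε hε
    exact ⟨δ, hδ, fun x hx n => hU (H x hx n)⟩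
  · obtain ⟨δ, hδ, H⟩ := h _ (Metric.ball_mem_nhds p hε)
    exact ⟨δ, hδ, fun x hx n => H hx n⟩

/-- Asymptotic stability of a fixed point is invariant under topological conjugacy. -/
theorem IsAsymptoticallyStableOrbit.conj {f : E → E} {g : E' → E'} {p : E'} (hp : g p = p)
    (h : IsAsymptoticallyStableOrbit g p) (e : E' ≃ₜ E) (he : ∀ y, f (e y) = e (g y)) :
    IsAsymptoticallyStableOrbit f (e p) := by
  have hfe : f (e p) = e p := by rw [he, hp]
  rw [isAsymptoticallyStableOrbit_iff_of_fixed hp] at h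
  rw [isAsymptoticallyStableOrbit_iff_of_fixed hfe]
  have hit : ∀ (n : ℕ) (y : E'), f^[n] (e y) = e (g^[n] y) := fun n y =>
    ((Function.Semiconj.iterate_right (f := e) (ga := g) (gb := f) (fun y => (he y).symm) n) y).symm
  rw [← e.map_nhds_eq]
  simp only [eventually_map, hit]
  refine ⟨fun U hU => ?_, h.2.mono fun x hx => ?_⟩
  · exact h.1 _ hU
  · rw [e.map_nhds_eq]; exact (e.continuous.tendsto p).comp hx

/-- A two-periodic point inherits asymptotic stability from the second iterate. -/
theorem IsAsymptoticallyStableOrbit.of_comp_self {f : E → E} {p : E} (hp : f (f p) = p)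
    (hf : ContinuousAt f p) (h : IsAsymptoticallyStableOrbit (f ∘ f) p) :
    IsAsymptoticallyStableOrbit f p := by
  have heven : ∀ (m : ℕ) (x : E), f^[2 * m] x = (f ∘ f)^[m] x := fun m x => by
    rw [Function.iterate_mul]; rfl
  have hodd : ∀ (m : ℕ) (x : E), f^[2 * m + 1] x = f ((f ∘ f)^[m] x) := fun m x => by
    rw [Function.iterate_succ_apply', heven]
  have hpm : ∀ m : ℕ, (f ∘ f)^[m] p = p := fun m => Function.iterate_fixed hp m
  have hpar : ∀ n : ℕ, ∃ m, (n = 2 * m ∨ n = 2 * m + 1) ∧ n ≤ 2 * m + 1 := fun n =>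
    ⟨n / 2, by lia, by lia⟩
  have key : ∀ ε > 0, ∃ ε' > 0, ∀ (x : E) (n m : ℕ), (n = 2 * m ∨ n = 2 * m + 1) →
      dist ((f ∘ f)^[m] x) p < ε' → dist (f^[n] x) (f^[n] p) < ε := by
    intro ε hε
    obtain ⟨δ, hδ, hcont⟩ := Metric.continuousAt_iff.1 hf ε hε
    refine ⟨min δ ε, lt_min hδ hε, fun x n m hnm hd => ?_⟩
    rcases hnm with rfl | rfl
    · rw [heven, heven, hpm]; exact hd.trans_le (min_le_right _ _)
    · rw [hodd, hodd, hpm]; exact hcont (hd.trans_le (min_le_left _ _))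
  obtain ⟨h1, δ₂, hδ₂, h2⟩ := h
  refine ⟨fun ε hε => ?_, δ₂, hδ₂, fun x hx => ?_⟩
  · obtain ⟨ε', hε', hk⟩ := key ε hε
    obtain ⟨δ, hδ, H⟩ := h1 ε' hε'
    refine ⟨δ, hδ, fun x hx n => ?_⟩
    obtain ⟨m, hm, -⟩ := hpar n
    exact hk x n m hm (by simpa [hpm] using H x hx m)
  · have hlim := h2 x hx
    simp only [hpm] at hlim
    refine Metric.tendsto_atTop.2 fun ε hε => ?_
    obtain ⟨ε', hε', hk⟩ := key ε hε
    obtain ⟨N, hN⟩ := Metric.tendsto_atTop.1 hlim ε' hε'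
    refine ⟨2 * N + 1, fun n hn => ?_⟩
    obtain ⟨m, hm, hm'⟩ := hpar n
    have := hk x n m hm (by simpa using hN m (by lia))
    simpa using this

theorem IsAsymptoticallyStableOrbit.map {f : E → E} {p : E} (hp : f (f p) = p)
    (hf : ContinuousAt f (f p)) (h : IsAsymptoticallyStableOrbit f p) :
    IsAsymptoticallyStableOrbit f (f p) := by
  obtain ⟨h1, δ₂, hδ₂, h2⟩ := h
  have hpn : ∀ n : ℕ, f^[n + 1] (f p) = f^[n] p := fun n => by
    rw [Function.iterate_succ_apply, hp]
  refine ⟨fun ε hε => ?_, ?_⟩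
  · obtain ⟨δ, hδ, H⟩ := h1 ε hε
    obtain ⟨r, hr, hc⟩ := Metric.continuousAt_iff.1 hf δ hδ
    refine ⟨min r ε, lt_min hr hε, fun x hx n => ?_⟩
    cases n with
    | zero => exact hx.trans_le (min_le_right _ _)
    | succ n =>
      rw [hpn, Function.iterate_succ_apply]
      exact H _ (by simpa [hp] using hc (hx.trans_le (min_le_left _ _))) n
  · obtain ⟨r, hr, hc⟩ := Metric.continuousAt_iff.1 hf δ₂ hδ₂
    refine ⟨r, hr, fun x hx => ?_⟩
    rw [← tendsto_add_atTop_iff_nat 1]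
    simp only [hpn, Function.iterate_succ_apply]
    exact h2 _ (by simpa [hp] using hc hx)

/-- A two-cycle found in a coordinate chart, together with the stability of the second iterate,
gives a stable two-cycle of the original map. -/
theorem isStableTwoCycle_of_conj {f : E → E} {F : E' → E'}
    (e : E' ≃ₜ E) (he : ∀ y, f (e y) = e (F y)) {p : E'} (hne : p ≠ F p) (hp : F (F p) = p)
    (hst : IsAsymptoticallyStableOrbit (F ∘ F) p) (hc : ContinuousAt f (e p))
    (hc' : ContinuousAt f (e (F p))) : IsStableTwoCycle f (e p) (e (F p)) := by
  have h2 : f (f (e p)) = e p := by rw [he, he, hp]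
  have hs : IsAsymptoticallyStableOrbit f (e p) :=
    .of_comp_self h2 hc (hst.conj hp e fun y => by simp [he])
  refine ⟨fun h => hne (e.injective h), he p, by rw [he, hp], hs, ?_⟩
  rw [← he] at hc' ⊢
  exact hs.map h2 hc'

/-- A map that contracts a closed ball towards its fixed centre is asymptotically stable there. -/
theorem IsAsymptoticallyStableOrbit.of_contracting {f : E → E} {p : E} {r κ : ℝ} (hp : f p = p)
    (hr : 0 < r) (hκ0 : 0 ≤ κ) (hκ : κ < 1)
    (h : ∀ x, dist x p ≤ r → dist (f x) p ≤ κ * dist x p) : IsAsymptoticallyStableOrbit f p := by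
  have hit : ∀ (n : ℕ) (x : E), dist x p ≤ r → dist (f^[n] x) p ≤ κ ^ n * dist x p := by
    intro n
    induction n with
    | zero => intro x _; simp
    | succ n ih =>
      intro x hx
      have h1 := h x hx
      have h2 : dist (f x) p ≤ r :=
        h1.trans ((mul_le_of_le_one_left dist_nonneg hκ.le).trans hx)
      rw [Function.iterate_succ_apply, pow_succ, mul_assoc]
      exact (ih _ h2).trans (mul_le_mul_of_nonneg_left h1 (by positivity))
  have hn : ∀ n : ℕ, f^[n] p = p := fun n => Function.iterate_fixed hp n
  refine ⟨fun ε hε => ⟨min r ε, lt_min hr hε, fun x hx n => ?_⟩, r, hr, fun x hx => ?_⟩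
  · rw [hn]
    refine (hit n x (hx.le.trans (min_le_left _ _))).trans_lt ?_
    exact (mul_le_of_le_one_left dist_nonneg (pow_le_one₀ hκ0 hκ.le)).trans_lt
      (hx.trans_le (min_le_right _ _))
  · simp only [hn]
    refine squeeze_zero (fun _ => dist_nonneg) (fun n => hit n x hx.le) ?_
    simpa using (tendsto_pow_atTop_nhds_zero_of_lt_one hκ0 hκ).mul_const (dist x p)

end Stability

/-! ### Attracting fixed points of slow–fast maps -/

section SlowFast

variable {K : Type*} [NormedAddCommGroup K] [CompleteSpace K]

/-- A map that contracts distances on a closed ball and moves its centre little has a fixed point in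
this ball, and this fixed point is asymptotically stable. The two components may contract with
different constants; each of them has to move by little only relative to its own constant. -/
theorem exists_stable_fixedPoint_of_contracting {G : ℝ × K → ℝ × K} {ρ κ₁ κ₂ : ℝ} (hρ : 0 < ρ)
    (h10 : 0 ≤ κ₁) (h11 : κ₁ < 1) (h20 : 0 ≤ κ₂) (h21 : κ₂ < 1)
    (hL1 : ∀ x ∈ Metric.closedBall (0 : ℝ × K) ρ, ∀ y ∈ Metric.closedBall (0 : ℝ × K) ρ,
      ‖(G x).1 - (G y).1‖ ≤ κ₁ * ‖x - y‖)
    (hL2 : ∀ x ∈ Metric.closedBall (0 : ℝ × K) ρ, ∀ y ∈ Metric.closedBall (0 : ℝ × K) ρ,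
      ‖(G x).2 - (G y).2‖ ≤ κ₂ * ‖x - y‖)
    (hc1 : ‖(G 0).1‖ ≤ (1 - κ₁) * (ρ / 2)) (hc2 : ‖(G 0).2‖ ≤ (1 - κ₂) * (ρ / 2)) :
    ∃ p ∈ Metric.closedBall (0 : ℝ × K) ρ, G p = p ∧ IsAsymptoticallyStableOrbit G p := by
  set κ := max κ₁ κ₂ with hκdef
  have hκ0 : 0 ≤ κ := h10.trans (le_max_left _ _)
  have hκ1 : κ < 1 := max_lt h11 h21
  have hL : ∀ x ∈ Metric.closedBall (0 : ℝ × K) ρ, ∀ y ∈ Metric.closedBall (0 : ℝ × K) ρ,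
      dist (G x) (G y) ≤ κ * dist x y := by
    intro x hx y hy
    rw [dist_eq_norm, dist_eq_norm, Prod.norm_def]
    refine max_le ?_ ?_
    · exact (hL1 x hx y hy).trans (mul_le_mul_of_nonneg_right (le_max_left _ _) (norm_nonneg _))
    · exact (hL2 x hx y hy).trans (mul_le_mul_of_nonneg_right (le_max_right _ _) (norm_nonneg _))
  have hsub : Metric.closedBall (0 : ℝ × K) (ρ / 2) ⊆ Metric.closedBall (0 : ℝ × K) ρ :=
    Metric.closedBall_subset_closedBall (by linarith)
  have h0 : (0 : ℝ × K) ∈ Metric.closedBall (0 : ℝ × K) ρ := Metric.mem_closedBall_self hρ.le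
  have hmaps : Set.MapsTo G (Metric.closedBall (0 : ℝ × K) (ρ / 2))
      (Metric.closedBall (0 : ℝ × K) (ρ / 2)) := by
    intro x hx
    have hxn : ‖x‖ ≤ ρ / 2 := by simpa using hx
    rw [mem_closedBall_zero_iff, Prod.norm_def]
    refine max_le ?_ ?_
    · have h1 := hL1 x (hsub hx) 0 h0
      rw [sub_zero] at h1
      have h2 := norm_add_le ((G x).1 - (G 0).1) (G 0).1
      rw [sub_add_cancel] at h2
      have h3 := mul_le_mul_of_nonneg_left hxn h10
      linarith
    · have h1 := hL2 x (hsub hx) 0 h0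
      rw [sub_zero] at h1
      have h2 := norm_add_le ((G x).2 - (G 0).2) (G 0).2
      rw [sub_add_cancel] at h2
      have h3 := mul_le_mul_of_nonneg_left hxn h20
      linarith
  have hcontr : ContractingWith ⟨κ, hκ0⟩ (hmaps.restrict G _ _) := by
    refine ⟨by exact_mod_cast hκ1, LipschitzWith.of_dist_le_mul fun x y => ?_⟩
    exact hL x (hsub x.2) y (hsub y.2)
  obtain ⟨p, hp, hfix, -, -⟩ := hcontr.exists_fixedPoint' Metric.isClosed_closedBall.isComplete
    hmaps (Metric.mem_closedBall_self (by linarith)) (edist_ne_top 0 (G 0))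
  have hfix : G p = p := hfix
  refine ⟨p, hsub hp, hfix, .of_contracting hfix (half_pos hρ) hκ0 hκ1 fun x hx => ?_⟩
  have hx' : x ∈ Metric.closedBall (0 : ℝ × K) ρ := by
    rw [Metric.mem_closedBall] at hp ⊢
    linarith [dist_triangle x p 0]
  simpa [hfix] using hL x hx' p (hsub hp)

variable [NormedSpace ℝ K]

/-- Slow–fast maps `(a, z) ↦ (a + s² q(a, z), Z(a, z))` for which the slow drift `q` contracts in
`a` more strongly than it responds to `z`, while the fast part contracts `z` at a fixed rate. Both
components contract the sup norm, the slow one with rate `1 - O(s²)`. -/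
theorem exists_stable_fixedPoint_of_slowFast_aux {G : ℝ → ℝ × K → ℝ × K} {q : ℝ → ℝ × K → ℝ}
    {q' : ℝ × K →L[ℝ] ℝ} {Z' : ℝ × K →L[ℝ] K} {N : K →L[ℝ] K} {b : K →L[ℝ] ℝ} {c : ℝ}
    (hG : ∀ s x, (G s x).1 = x.1 + s ^ 2 * q s x)
    (hq : HasStrictFDerivAlong (𝓝[>] (0 : ℝ)) q q' 0 0)
    (hZ : HasStrictFDerivAlong (𝓝[>] (0 : ℝ)) (fun s x => (G s x).2) Z' 0 0)
    (hq' : ∀ x, q' x = -c * x.1 + b x.2) (hbc : ‖b‖ < c)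
    (hZ' : ∀ x, Z' x = N x.2) (hN : ‖N‖ < 1) {V : Set (ℝ × K)} (hV : V ∈ 𝓝 0) :
    ∀ᶠ s in 𝓝[>] (0 : ℝ), ∃ p ∈ V, G s p = p ∧ IsAsymptoticallyStableOrbit (G s) p := by
  have hc : 0 < c := (norm_nonneg b).trans_lt hbc
  set c₁ := (c - ‖b‖) / 2 with hc₁
  set n₁ := (1 - ‖N‖) / 2 with hn₁
  have hc₁0 : 0 < c₁ := by rw [hc₁]; linarith
  have hn₁0 : 0 < n₁ := by rw [hn₁]; linarith
  obtain ⟨ρ₁, hρ₁, H1⟩ := hq.exists_closedBall hc₁0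
  obtain ⟨ρ₂, hρ₂, H2⟩ := hZ.exists_closedBall hn₁0
  obtain ⟨ρ₃, hρ₃, H3⟩ := Metric.nhds_basis_closedBall.mem_iff.1 hV
  set ρ := min ρ₁ (min ρ₂ ρ₃)
  have hρ : 0 < ρ := lt_min hρ₁ (lt_min hρ₂ hρ₃)
  have hs1 : Metric.closedBall (0 : ℝ × K) ρ ⊆ Metric.closedBall 0 ρ₁ :=
    Metric.closedBall_subset_closedBall (min_le_left _ _)
  have hs2 : Metric.closedBall (0 : ℝ × K) ρ ⊆ Metric.closedBall 0 ρ₂ :=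
    Metric.closedBall_subset_closedBall ((min_le_right _ _).trans (min_le_left _ _))
  have hs3 : Metric.closedBall (0 : ℝ × K) ρ ⊆ Metric.closedBall 0 ρ₃ :=
    Metric.closedBall_subset_closedBall ((min_le_right _ _).trans (min_le_right _ _))
  have hq0 : ∀ᶠ s in 𝓝[>] (0 : ℝ), ‖q s 0‖ < c₁ * (ρ / 2) := by
    have := hq.1.norm
    rw [norm_zero] at this
    exact this.eventually_lt_const (by positivity)
  have hZ0 : ∀ᶠ s in 𝓝[>] (0 : ℝ), ‖(G s 0).2‖ < n₁ * (ρ / 2) := by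
    have := hZ.1.norm
    rw [norm_zero] at this
    exact this.eventually_lt_const (by positivity)
  have hsc : ∀ᶠ s in 𝓝[>] (0 : ℝ), s ^ 2 * c < 1 := by
    have : Tendsto (fun s : ℝ => s ^ 2 * c) (𝓝[>] 0) (𝓝 (0 ^ 2 * c)) :=
      (Continuous.tendsto (by fun_prop) 0).mono_left nhdsWithin_le_nhds
    exact this.eventually_lt_const (by norm_num)
  filter_upwards [H1, H2, hq0, hZ0, hsc, self_mem_nhdsWithin] with s h1 h2 h3 h4 h5 h6
  have hs : (0 : ℝ) < s := h6
  have hs2' : 0 < s ^ 2 := by positivity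
  have hcc : c₁ ≤ c := by rw [hc₁]; linarith [norm_nonneg b]
  have hscc : s ^ 2 * c₁ ≤ s ^ 2 * c := mul_le_mul_of_nonneg_left hcc hs2'.le
  have main := exists_stable_fixedPoint_of_contracting (G := G s) (ρ := ρ)
    (κ₁ := 1 - s ^ 2 * c₁) (κ₂ := 1 - n₁) hρ (by linarith)
    (by nlinarith) (by rw [hn₁]; linarith [norm_nonneg N]) (by linarith) ?_ ?_ ?_ ?_
  · obtain ⟨p, hp, hfix, hst⟩ := main
    exact ⟨p, H3 (hs3 hp), hfix, hst⟩
  · intro x hx y hy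
    have e := h1 x (hs1 hx) y (hs1 hy)
    have hfst : ‖(x - y).1‖ ≤ ‖x - y‖ := norm_fst_le _
    have hb : ‖b (x - y).2‖ ≤ ‖b‖ * ‖x - y‖ :=
      (b.le_opNorm _).trans (mul_le_mul_of_nonneg_left (norm_snd_le _) (norm_nonneg _))
    have key : (G s x).1 - (G s y).1 = (1 - s ^ 2 * c) * (x - y).1 +
        s ^ 2 * (b (x - y).2 + (q s x - q s y - q' (x - y))) := by
      rw [hG, hG, hq', Prod.fst_sub]; ring
    rw [key]
    refine (norm_add_le _ _).trans ?_
    rw [norm_mul, norm_mul, Real.norm_of_nonneg (by linarith : 0 ≤ 1 - s ^ 2 * c),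
      Real.norm_of_nonneg hs2'.le]
    have t1 := mul_le_mul_of_nonneg_left hfst (by linarith : 0 ≤ 1 - s ^ 2 * c)
    have t2 := mul_le_mul_of_nonneg_left
      ((norm_add_le (b (x - y).2) (q s x - q s y - q' (x - y))).trans (add_le_add hb e)) hs2'.le
    refine (add_le_add t1 t2).trans (le_of_eq ?_)
    rw [hc₁]; ring
  · intro x hx y hy
    have e := h2 x (hs2 hx) y (hs2 hy)
    have hb : ‖N (x - y).2‖ ≤ ‖N‖ * ‖x - y‖ :=
      (N.le_opNorm _).trans (mul_le_mul_of_nonneg_left (norm_snd_le _) (norm_nonneg _))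
    have key : (G s x).2 - (G s y).2 = N (x - y).2 +
        ((G s x).2 - (G s y).2 - Z' (x - y)) := by rw [hZ']; abel
    rw [key]
    refine (norm_add_le _ _).trans ((add_le_add hb e).trans (le_of_eq ?_))
    rw [hn₁]; ring
  · rw [hG, Prod.fst_zero, zero_add, norm_mul, Real.norm_of_nonneg hs2'.le]
    refine (mul_le_mul_of_nonneg_left h3.le hs2'.le).trans (le_of_eq (by ring))
  · refine h4.le.trans (le_of_eq (by ring))

/-- Slow–fast maps `(a, w) ↦ (a + s² q(a, w), Y(a, w))` near a common zero `p₀` of `q` and of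
`Y - w`. The direction `(1, h)` is tangent to the curve of fixed points of the fast dynamics; if the
fast dynamics contracts transversally and `q` decreases along this curve, then for small `s` there
is an asymptotically stable fixed point near `p₀`. -/
theorem exists_stable_fixedPoint_of_slowFast {G : ℝ → ℝ × K → ℝ × K} {q : ℝ → ℝ × K → ℝ}
    {q' : ℝ × K →L[ℝ] ℝ} {Y' : ℝ × K →L[ℝ] K} {N : K →L[ℝ] K} {h : K} {p₀ : ℝ × K}
    (hG : ∀ s x, (G s x).1 = x.1 + s ^ 2 * q s x)
    (hq : HasStrictFDerivAlong (𝓝[>] (0 : ℝ)) q q' p₀ 0)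
    (hY : HasStrictFDerivAlong (𝓝[>] (0 : ℝ)) (fun s x => (G s x).2) Y' p₀ p₀.2)
    (hqh : q' (1, h) < 0) (hYh : Y' (1, h) = h) (hYN : ∀ w, Y' (0, w) = N w) (hN : ‖N‖ < 1)
    {V : Set (ℝ × K)} (hV : V ∈ 𝓝 p₀) :
    ∀ᶠ s in 𝓝[>] (0 : ℝ), ∃ p ∈ V, G s p = p ∧ IsAsymptoticallyStableOrbit (G s) p := by
  set c := -q' (1, h) with hc
  set b := q'.comp (ContinuousLinearMap.inr ℝ ℝ K) with hb
  -- `θ` weighs the fast variable so little that its influence on the slow drift is negligible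
  obtain ⟨θ, hθ, hθb⟩ : ∃ θ > 0, θ * ‖b‖ < c := by
    have hc0 : 0 < c := by rw [hc]; linarith
    refine ⟨c / (‖b‖ + 1), by positivity, ?_⟩
    rw [div_mul_eq_mul_div, div_lt_iff₀ (by positivity)]
    nlinarith
  -- the linear change of variables straightening the slow direction
  let A : (ℝ × K) →L[ℝ] (ℝ × K) := (ContinuousLinearMap.fst ℝ ℝ K).prod
    ((ContinuousLinearMap.fst ℝ ℝ K).smulRight h + θ • ContinuousLinearMap.snd ℝ ℝ K)
  let B : (ℝ × K) →L[ℝ] (ℝ × K) := (ContinuousLinearMap.fst ℝ ℝ K).prod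
    (θ⁻¹ • (ContinuousLinearMap.snd ℝ ℝ K - (ContinuousLinearMap.fst ℝ ℝ K).smulRight h))
  have hA : ∀ x : ℝ × K, A x = (x.1, x.1 • h + θ • x.2) := fun x => rfl
  have hB : ∀ x : ℝ × K, B x = (x.1, θ⁻¹ • (x.2 - x.1 • h)) := fun x => rfl
  have hBA : ∀ x, B (A x) = x := fun x => by
    rw [hB, hA]; ext <;> simp [smul_smul, inv_mul_cancel₀ hθ.ne']
  have hAB : ∀ x, A (B x) = x := fun x => by
    rw [hB, hA]; ext <;> simp [smul_smul, mul_inv_cancel₀ hθ.ne']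
  let e : ℝ × K ≃ₜ ℝ × K :=
    { toFun := fun x => p₀ + A x
      invFun := fun y => B (y - p₀)
      left_inv := fun x => by simp [hBA]
      right_inv := fun y => by simp [hAB]
      continuous_toFun := by fun_prop
      continuous_invFun := by fun_prop }
  have he0 : e 0 = p₀ := by change p₀ + A 0 = p₀; simp
  have hes : HasStrictFDerivAlong (𝓝[>] (0 : ℝ)) (fun _ x => e x) A 0 p₀ := by
    have : HasStrictFDerivAt (fun x => p₀ + A x) A 0 := A.hasStrictFDerivAt.const_add p₀
    exact (HasStrictFDerivAlong.of_strict this).congr_deriv (fun _ => rfl) he0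
  have hsq : Tendsto (fun s : ℝ => s ^ 2) (𝓝[>] 0) (𝓝 0) := by
    have : Tendsto (fun s : ℝ => s ^ 2) (𝓝[>] 0) (𝓝 (0 ^ 2)) :=
      (Continuous.tendsto (by fun_prop) 0).mono_left nhdsWithin_le_nhds
    simpa using this
  have hqe := hq.comp hes
  have hYe := hY.comp hes
  have hfst : HasStrictFDerivAlong (𝓝[>] (0 : ℝ)) (fun (_ : ℝ) (x : ℝ × K) => x.1)
      (ContinuousLinearMap.fst ℝ ℝ K) 0 (0 : ℝ × K).1 :=
    .of_strict (ContinuousLinearMap.fst ℝ ℝ K).hasStrictFDerivAt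
  have hZ := HasStrictFDerivAlong.clm (θ⁻¹ • ContinuousLinearMap.id ℝ K)
    ((hYe.sub (.of_tendsto tendsto_const_nhds : HasStrictFDerivAlong (𝓝[>] (0 : ℝ))
      (fun _ _ => p₀.2) 0 (0 : ℝ × K) p₀.2)).sub (HasStrictFDerivAlong.clm
      ((ContinuousLinearMap.id ℝ ℝ).smulRight h)
        (hfst.add (HasStrictFDerivAlong.tendsto_smul hsq hqe))))
  have hsplit : ∀ (a : ℝ) (w : K), (a, w) = a • ((1 : ℝ), h) + ((0 : ℝ), w - a • h) := by
    intro a w; ext <;> simp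
  have main := exists_stable_fixedPoint_of_slowFast_aux
    (G := fun s x => B (G s (e x) - p₀)) (q := fun s x => q s (e x)) (q' := q'.comp A)
    (b := θ • b) (c := c) (N := N) (V := e ⁻¹' V) ?_ hqe 
    ((hZ.congr' (.of_forall fun s x => ?_)).congr_deriv (fun _ => rfl) (by simp))
    ?_ ?_ ?_ hN (e.continuous.continuousAt.preimage_mem_nhds (by rwa [he0]))
  · refine main.mono fun s hs => ?_
    obtain ⟨p, hp, hfix, hst⟩ := hs
    have hconj : ∀ x, G s (e x) = e (B (G s (e x) - p₀)) := fun x => by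
      change _ = p₀ + A _; rw [hAB]; abel
    refine ⟨e p, hp, ?_, hst.conj hfix e hconj⟩
    conv_rhs => rw [← hfix]
    exact hconj p
  · intro s x
    change (G s (p₀ + A x) - p₀).1 = _
    rw [Prod.fst_sub, hG, Prod.fst_add]
    change p₀.1 + x.1 + _ - _ = x.1 + s ^ 2 * q s (p₀ + A x)
    ring
  · rw [hB]
    have : (G s (e x)).1 = p₀.1 + x.1 + s ^ 2 * q s (e x) := hG s (e x)
    have h1 : (G s (e x) - p₀).1 = x.1 + s ^ 2 * q s (e x) := by
      rw [Prod.fst_sub, this]; ring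
    rw [h1]
    rfl
  · intro x
    have h2 : ((0 : ℝ), θ • x.2) = θ • ((0 : ℝ), x.2) := by simp
    rw [ContinuousLinearMap.comp_apply, hA, hsplit, map_add, map_smul, hc, hb]
    simp only [add_sub_cancel_left, h2, map_smul, smul_eq_mul, FunLike.coe_smul, Pi.smul_apply,
      ContinuousLinearMap.comp_apply, ContinuousLinearMap.inr_apply]
    ring
  · rw [norm_smul, Real.norm_of_nonneg hθ.le]; exact hθb
  · intro x
    simp only [ContinuousLinearMap.comp_apply, sub_apply, hA]
    rw [hsplit x.1, map_add, map_smul, hYh, hYN]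
    simp [smul_smul, mul_inv_cancel₀ hθ.ne']

end SlowFast

/-! ### The flip bifurcation in rescaled coordinates -/

section Flip

variable {K : Type*} [NormedAddCommGroup K] [NormedSpace ℝ K] [CompleteSpace K]

/-- A family of maps `F s` whose first component is `a ↦ -a - s τ a² - s² X` with
`X → k a + a ℓ(w) + β a³`, and whose second component tends to `M w - (a² / 2) (h - M h)`. The
parabola `w = -(a² / 2) h` is the limiting center manifold; on it the second iterate drifts by
`s² (2 k a - (ℓ(h) - 2 β + 2 τ²) a³)`, so that for `k = ℓ(h) / 2 - β + τ²` there is a cycle with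
`a ≈ ± 1`, attracting as soon as `k > 0`. -/
theorem exists_stable_twoCycle_of_flip {F : ℝ → ℝ × K → ℝ × K} {X : ℝ → ℝ × K → ℝ} {τ β k : ℝ}
    {ℓ : K →L[ℝ] ℝ} {M : K →L[ℝ] K} {h : K}
    (hF : ∀ s x, (F s x).1 = -x.1 - s * (τ * x.1 ^ 2 + s * X s x))
    (hX : ∀ x, HasStrictFDerivAlong (𝓝[>] (0 : ℝ)) X
      ((k + ℓ x.2 + 3 * β * x.1 ^ 2) • ContinuousLinearMap.fst ℝ ℝ K +
        x.1 • ℓ.comp (ContinuousLinearMap.snd ℝ ℝ K)) x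
      (k * x.1 + x.1 * ℓ x.2 + β * x.1 ^ 3))
    (hY : ∀ x, HasStrictFDerivAlong (𝓝[>] (0 : ℝ)) (fun s x => (F s x).2)
      (M.comp (ContinuousLinearMap.snd ℝ ℝ K) -
        x.1 • (ContinuousLinearMap.fst ℝ ℝ K).smulRight (h - M h)) x
      (M x.2 - (x.1 ^ 2 / 2) • (h - M h)))
    (hk : k = ℓ h / 2 - β + τ ^ 2) (hk0 : 0 < k) (hM : ‖M‖ < 1) {V V' : Set (ℝ × K)}
    (hV : V ∈ 𝓝 ((1 : ℝ), -(1 / 2 : ℝ) • h)) (hV' : V' ∈ 𝓝 ((-1 : ℝ), -(1 / 2 : ℝ) • h)) :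
    ∀ᶠ s in 𝓝[>] (0 : ℝ), ∃ p ∈ V, F s p ∈ V' ∧ F s (F s p) = p ∧
      IsAsymptoticallyStableOrbit (F s ∘ F s) p := by
  set w₀ : K := -(1 / 2 : ℝ) • h with hw₀
  have hsid : Tendsto (fun s : ℝ => s) (𝓝[>] 0) (𝓝 0) := tendsto_id.mono_left nhdsWithin_le_nhds
  have hfst : ∀ x : ℝ × K, HasStrictFDerivAlong (𝓝[>] (0 : ℝ)) (fun (_ : ℝ) (x : ℝ × K) => x.1)
      (ContinuousLinearMap.fst ℝ ℝ K) x x.1 := fun x =>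
    .of_strict (ContinuousLinearMap.fst ℝ ℝ K).hasStrictFDerivAt
  have hA : ∀ x : ℝ × K, HasStrictFDerivAlong (𝓝[>] (0 : ℝ))
      (fun s (x : ℝ × K) => τ * x.1 ^ 2 + s * X s x)
      ((2 * τ * x.1) • ContinuousLinearMap.fst ℝ ℝ K) x (τ * x.1 ^ 2) := fun x =>
    (((HasStrictFDerivAlong.tendsto_smul (tendsto_const_nhds (x := τ))
      ((hfst x).smul (hfst x))).add (HasStrictFDerivAlong.tendsto_smul hsid (hX x))).congr'
      (.of_forall fun s x => by simp [sq])).congr_deriv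
      (fun y => by simp; ring) (by simp [sq])
  have hF1 : ∀ x : ℝ × K, HasStrictFDerivAlong (𝓝[>] (0 : ℝ)) (fun s (x : ℝ × K) => (F s x).1)
      (-ContinuousLinearMap.fst ℝ ℝ K) x (-x.1) := fun x =>
    (((HasStrictFDerivAlong.tendsto_smul (tendsto_const_nhds (x := (-1 : ℝ)))
      (hfst x)).sub (HasStrictFDerivAlong.tendsto_smul hsid (hA x))).congr'
      (.of_forall fun s x => by simp [hF])).congr_deriv
      (fun y => by simp) (by simp)
  have hFx : ∀ x : ℝ × K, HasStrictFDerivAlong (𝓝[>] (0 : ℝ)) F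
      ((-ContinuousLinearMap.fst ℝ ℝ K).prod (M.comp (ContinuousLinearMap.snd ℝ ℝ K) -
        x.1 • (ContinuousLinearMap.fst ℝ ℝ K).smulRight (h - M h))) x
      (-x.1, M x.2 - (x.1 ^ 2 / 2) • (h - M h)) := fun x => (hF1 x).prodMk (hY x)
  have hw₀M : M w₀ - ((1 : ℝ) / 2) • (h - M h) = w₀ := by
    rw [hw₀, map_smul]; module
  have hF0 : HasStrictFDerivAlong (𝓝[>] (0 : ℝ)) F
      ((-ContinuousLinearMap.fst ℝ ℝ K).prod (M.comp (ContinuousLinearMap.snd ℝ ℝ K) -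
        (ContinuousLinearMap.fst ℝ ℝ K).smulRight (h - M h))) (1, w₀) (-1, w₀) :=
    (hFx (1, w₀)).congr_deriv (fun y => by simp) (Prod.ext rfl (by simpa using hw₀M))
  have hX0 := hX (1, w₀)
  have hX1 := (hX (-1, w₀)).comp hF0
  have hY1 := (hY (-1, w₀)).comp hF0
  have hA0 := hA (1, w₀)
  -- the drift of the second iterate, divided by `s²`
  have hq := ((hX0.sub (HasStrictFDerivAlong.tendsto_smul (tendsto_const_nhds (x := 2 * τ))
    ((hfst (1, w₀)).smul hA0))).sub (HasStrictFDerivAlong.tendsto_smul (hsid.mul_const τ)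
    (hA0.smul hA0))).sub hX1
  have hℓw : ℓ w₀ = -(ℓ h / 2) := by rw [hw₀, map_smul, smul_eq_mul]; ring
  obtain ⟨pa, ha, pb, hb, hab⟩ := eventually_prod_iff.1 (hF0.tendsto.eventually hV')
  have key := exists_stable_fixedPoint_of_slowFast (G := fun s => F s ∘ F s)
    (h := -h) (N := M.comp M) (V := V ∩ {x | pb x}) (p₀ := (1, w₀)) ?_
    (hq.congr_deriv (fun _ => rfl) ?_) (hY1.congr_deriv (fun _ => rfl) ?_) ?_ ?_ ?_ ?_
    (inter_mem hV hb)
  · filter_upwards [key, ha] with s ⟨p, hp, hfix, hst⟩ has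
    exact ⟨p, hp.1, hab has hp.2, hfix, hst⟩
  · intro s x
    simp only [Function.comp_apply, smul_eq_mul]
    rw [hF s (F s x), hF s x]
    ring
  · simp [hℓw]
    rw [hk]; ring
  · simpa using hw₀M
  · simp [hℓw]
    nlinarith
  · simp
    abel
  · intro w
    simp
  · calc ‖M.comp M‖ ≤ ‖M‖ * ‖M‖ := M.opNorm_comp_le M
      _ < 1 := by nlinarith [norm_nonneg M]

end Flip

/-! ### The third-order Taylor remainder of a gradient field -/

section Taylor

open Asymptotics

variable {E F : Type*} [NormedAddCommGroup E] [NormedSpace ℝ E]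
  [NormedAddCommGroup F] [NormedSpace ℝ F]

/-- The third-order Taylor remainder of `g` at `x`. -/
noncomputable def taylorRemainder (g : E → F) (x y : E) : F :=
  g (x + y) - g x - fderiv ℝ g x y - (1 / 2 : ℝ) • fderiv ℝ (fderiv ℝ g) x y y -
    (1 / 6 : ℝ) • fderiv ℝ (fderiv ℝ (fderiv ℝ g)) x y y y

variable {g : E → F} {x : E}

theorem eventually_fderiv_fderiv_symm (h0 : ∀ᶠ y in 𝓝 x, DifferentiableAt ℝ g y)
    (h1 : ∀ᶠ y in 𝓝 x, DifferentiableAt ℝ (fderiv ℝ g) y) :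
    ∀ᶠ y in 𝓝 x, ∀ u w, fderiv ℝ (fderiv ℝ g) y u w = fderiv ℝ (fderiv ℝ g) y w u := by
  filter_upwards [h0.eventually_nhds, h1] with y hy0 hy1 u w
  exact second_derivative_symmetric_of_eventually
    (hy0.mono fun _ hz => hz.hasFDerivAt) hy1.hasFDerivAt u w

theorem fderiv_fderiv_fderiv_symm_left (h1 : ∀ᶠ y in 𝓝 x, DifferentiableAt ℝ (fderiv ℝ g) y)
    (h2 : DifferentiableAt ℝ (fderiv ℝ (fderiv ℝ g)) x) (u w : E) :
    fderiv ℝ (fderiv ℝ (fderiv ℝ g)) x u w = fderiv ℝ (fderiv ℝ (fderiv ℝ g)) x w u :=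
  second_derivative_symmetric_of_eventually
    (h1.mono fun _ hz => hz.hasFDerivAt) h2.hasFDerivAt u w

theorem fderiv_fderiv_fderiv_symm_right (h0 : ∀ᶠ y in 𝓝 x, DifferentiableAt ℝ g y)
    (h1 : ∀ᶠ y in 𝓝 x, DifferentiableAt ℝ (fderiv ℝ g) y)
    (h2 : DifferentiableAt ℝ (fderiv ℝ (fderiv ℝ g)) x) (u w z : E) :
    fderiv ℝ (fderiv ℝ (fderiv ℝ g)) x u w z = fderiv ℝ (fderiv ℝ (fderiv ℝ g)) x u z w := by
  have hD : ∀ w z : E, HasFDerivAt (fun y => fderiv ℝ (fderiv ℝ g) y w z)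
      (((fderiv ℝ (fderiv ℝ (fderiv ℝ g)) x).flip w).flip z) x := fun w z => by
    simpa using (h2.hasFDerivAt.clm_apply (hasFDerivAt_const w x)).clm_apply (hasFDerivAt_const z x)
  have heq : (fun y => fderiv ℝ (fderiv ℝ g) y w z) =ᶠ[𝓝 x]
      fun y => fderiv ℝ (fderiv ℝ g) y z w :=
    (eventually_fderiv_fderiv_symm h0 h1).mono fun y hy => hy w z
  have := ((hD w z).congr_of_eventuallyEq heq.symm).unique (hD z w)
  simpa using congrArg (fun A => A u) this

/-- The remainder of the first-order expansion of the second derivative, integrated once. -/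
theorem norm_fderiv_sub_taylor_le (h1 : ∀ᶠ y in 𝓝 x, DifferentiableAt ℝ (fderiv ℝ g) y)
    (h2 : DifferentiableAt ℝ (fderiv ℝ (fderiv ℝ g)) x) {ε : ℝ} (hε : 0 < ε) :
    ∀ᶠ y in 𝓝 (0 : E), ‖fderiv ℝ g (x + y) - fderiv ℝ g x - fderiv ℝ (fderiv ℝ g) x y -
      (1 / 2 : ℝ) • fderiv ℝ (fderiv ℝ (fderiv ℝ g)) x y y‖ ≤ ε * ‖y‖ ^ 2 := by
  set T := fderiv ℝ (fderiv ℝ g) x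
  set S := fderiv ℝ (fderiv ℝ (fderiv ℝ g)) x with hS
  have hshift : Tendsto (fun y : E => x + y) (𝓝 0) (𝓝 x) := by
    simpa using (continuous_const_add x).tendsto (0 : E)
  have hlin : ∀ᶠ y in 𝓝 (0 : E),
      ‖fderiv ℝ (fderiv ℝ g) (x + y) - T - S y‖ ≤ ε * ‖y‖ := by
    have := (hasFDerivAt_iff_isLittleO_nhds_zero (𝕜 := ℝ) (F := E →L[ℝ] E →L[ℝ] F)).1
      h2.hasFDerivAt
    exact this.def hε
  obtain ⟨δ, hδ, H⟩ := Metric.nhds_basis_ball.eventually_iff.1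
    (hlin.and (hshift.eventually h1))
  refine Metric.nhds_basis_ball.eventually_iff.2 ⟨δ, hδ, fun {y} hy => ?_⟩
  set σ : E → E →L[ℝ] F := fun y => fderiv ℝ g (x + y) - fderiv ℝ g x - T y - (1 / 2 : ℝ) • S y y
  have hσ : ∀ z ∈ Metric.ball (0 : E) δ,
      HasFDerivAt σ (fderiv ℝ (fderiv ℝ g) (x + z) - T - S z) z := by
    intro z hz
    have e1 : HasFDerivAt (fun y => fderiv ℝ g (x + y)) (fderiv ℝ (fderiv ℝ g) (x + z)) z :=
      (hasFDerivAt_comp_add_left x).2 (H hz).2.hasFDerivAt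
    have e2 : HasFDerivAt (fun y => S y y) (S z + S.flip z) z := by
      simpa using S.hasFDerivAt.clm_apply (hasFDerivAt_id z)
    have e3 := ((e1.sub_const (fderiv ℝ g x)).sub T.hasFDerivAt).sub (e2.const_smul (1 / 2 : ℝ))
    convert! e3 using 2
    ext u : 1
    have hsym : S u z = S z u := fderiv_fderiv_fderiv_symm_left h1 h2 u z
    simp only [FunLike.coe_smul, Pi.smul_apply, add_apply, ContinuousLinearMap.flip_apply, hsym]
    module
  have hball : Metric.closedBall (0 : E) ‖y‖ ⊆ Metric.ball 0 δ :=
    Metric.closedBall_subset_ball (by simpa using hy)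
  have := (convex_closedBall (0 : E) ‖y‖).norm_image_sub_le_of_norm_hasFDerivWithin_le
    (f := σ) (C := ε * ‖y‖) (x := 0) (y := y)
    (fun z hz => (hσ z (hball hz)).hasFDerivWithinAt)
    (fun z hz => (H (hball hz)).1.trans
      (mul_le_mul_of_nonneg_left (by simpa using hz) hε.le))
    (by simp) (by simp)
  have h0 : σ 0 = 0 := by simp [σ]
  rw [h0, sub_zero, sub_zero] at this
  calc ‖σ y‖ ≤ ε * ‖y‖ * ‖y‖ := this
    _ = ε * ‖y‖ ^ 2 := by ring

/-- On a ball of radius `r`, the third-order remainder is Lipschitz with constant `o(r ^ 2)`. -/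
theorem norm_taylorRemainder_sub_le (h0 : ∀ᶠ y in 𝓝 x, DifferentiableAt ℝ g y)
    (h1 : ∀ᶠ y in 𝓝 x, DifferentiableAt ℝ (fderiv ℝ g) y)
    (h2 : DifferentiableAt ℝ (fderiv ℝ (fderiv ℝ g)) x) {ε : ℝ} (hε : 0 < ε) :
    ∃ δ > 0, ∀ r < δ, ∀ y z : E, ‖y‖ ≤ r → ‖z‖ ≤ r →
      ‖taylorRemainder g x y - taylorRemainder g x z‖ ≤ ε * r ^ 2 * ‖y - z‖ := by
  set T := fderiv ℝ (fderiv ℝ g) x with hT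
  set S := fderiv ℝ (fderiv ℝ (fderiv ℝ g)) x with hS
  have hshift : Tendsto (fun y : E => x + y) (𝓝 0) (𝓝 x) := by
    simpa using (continuous_const_add x).tendsto (0 : E)
  obtain ⟨δ, hδ, H⟩ := Metric.nhds_basis_ball.eventually_iff.1
    ((norm_fderiv_sub_taylor_le h1 h2 hε).and (hshift.eventually h0))
  refine ⟨δ, hδ, fun r hr y z hy hz => ?_⟩
  have hball : Metric.closedBall (0 : E) r ⊆ Metric.ball 0 δ := Metric.closedBall_subset_ball hr
  have hder : ∀ z ∈ Metric.ball (0 : E) δ, HasFDerivAt (taylorRemainder g x)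
      (fderiv ℝ g (x + z) - fderiv ℝ g x - T z - (1 / 2 : ℝ) • S z z) z := by
    intro z hz
    have e1 : HasFDerivAt (fun y => g (x + y)) (fderiv ℝ g (x + z)) z :=
      (hasFDerivAt_comp_add_left x).2 (H hz).2.hasFDerivAt
    have e2 : HasFDerivAt (fun y => T y y) (T z + T.flip z) z := by
      simpa using T.hasFDerivAt.clm_apply (hasFDerivAt_id z)
    have e3 : HasFDerivAt (fun y => S y y) (S z + S.flip z) z := by
      simpa using S.hasFDerivAt.clm_apply (hasFDerivAt_id z)
    have e4 : HasFDerivAt (fun y => S y y y) (S z z + (S z + S.flip z).flip z) z := by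
      simpa using e3.clm_apply (hasFDerivAt_id z)
    have e5 := ((((e1.sub_const (g x)).sub (fderiv ℝ g x).hasFDerivAt).sub
      (e2.const_smul (1 / 2 : ℝ))).sub (e4.const_smul (1 / 6 : ℝ)))
    convert! e5 using 1
    ext u : 1
    have hsym1 : T u z = T z u := (eventually_fderiv_fderiv_symm h0 h1).self_of_nhds u z
    have hsym2 : S u z = S z u := fderiv_fderiv_fderiv_symm_left h1 h2 u z
    have hsym3 : S z u z = S z z u := fderiv_fderiv_fderiv_symm_right h0 h1 h2 z u z
    simp only [FunLike.coe_smul, Pi.smul_apply, add_apply, sub_apply,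
      ContinuousLinearMap.flip_apply, hsym1, hsym2, hsym3]
    module
  refine (convex_closedBall (0 : E) r).norm_image_sub_le_of_norm_hasFDerivWithin_le
    (fun z hz => (hder z (hball hz)).hasFDerivWithinAt) (fun z hz => ?_)
    (by simpa using hz) (by simpa using hy)
  have hz' : ‖z‖ ≤ r := by simpa using hz
  exact (H (hball hz)).1.trans (by gcongr)

/-- The Taylor remainder along `s • u`, divided by `s ^ 3`, is negligible when `u` is a family with
a strict derivative. -/
theorem hasStrictFDerivAlong_taylorRemainder {X : Type*} [NormedAddCommGroup X] [NormedSpace ℝ X]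
    (h0 : ∀ᶠ y in 𝓝 x, DifferentiableAt ℝ g y)
    (h1 : ∀ᶠ y in 𝓝 x, DifferentiableAt ℝ (fderiv ℝ g) y)
    (h2 : DifferentiableAt ℝ (fderiv ℝ (fderiv ℝ g)) x)
    {u : ℝ → X → E} {u' : X →L[ℝ] E} {x₀ : X} {u₀ : E}
    (hu : HasStrictFDerivAlong (𝓝[>] (0 : ℝ)) u u' x₀ u₀) :
    HasStrictFDerivAlong (𝓝[>] (0 : ℝ))
      (fun s y => (s ^ 3)⁻¹ • taylorRemainder g x (s • u s y)) 0 x₀ 0 := by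
  have hbound : ∀ ε > 0, ∀ᶠ s in 𝓝[>] (0 : ℝ), ∀ y z : E, ‖y‖ ≤ ‖u₀‖ + 1 → ‖z‖ ≤ ‖u₀‖ + 1 →
      ‖(s ^ 3)⁻¹ • taylorRemainder g x (s • y) - (s ^ 3)⁻¹ • taylorRemainder g x (s • z)‖ ≤
        ε * ‖y - z‖ := by
    intro ε hε
    set C := ‖u₀‖ + 1
    have hC : 0 < C := by positivity
    obtain ⟨δ, hδ, H⟩ := norm_taylorRemainder_sub_le h0 h1 h2 (ε := ε / C ^ 2) (by positivity)
    have hs : ∀ᶠ s in 𝓝[>] (0 : ℝ), s * C < δ := by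
      have : Tendsto (fun s : ℝ => s * C) (𝓝[>] 0) (𝓝 (0 * C)) :=
        (Continuous.tendsto (by fun_prop) 0).mono_left nhdsWithin_le_nhds
      exact this.eventually_lt_const (by simpa using hδ)
    filter_upwards [hs, self_mem_nhdsWithin] with s hs hs0 y z hy hz
    have hs0 : 0 < s := hs0
    have hn : ∀ y : E, ‖y‖ ≤ C → ‖s • y‖ ≤ s * C := fun y hy => by
      rw [norm_smul, Real.norm_of_nonneg hs0.le]; gcongr
    have := H (s * C) hs (s • y) (s • z) (hn y hy) (hn z hz)
    rw [← smul_sub, norm_smul, norm_inv, Real.norm_of_nonneg (by positivity),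
      inv_mul_le_iff₀ (by positivity)]
    refine this.trans (le_of_eq ?_)
    rw [← smul_sub, norm_smul, Real.norm_of_nonneg hs0.le]
    field_simp
  have hnear : ∀ᶠ p in 𝓝[>] (0 : ℝ) ×ˢ 𝓝 x₀, ‖u p.1 p.2‖ < ‖u₀‖ + 1 :=
    hu.tendsto.norm.eventually_lt_const (by linarith)
  constructor
  · refine Metric.tendsto_nhds.2 fun ε hε => ?_
    have hC : 0 < ‖u₀‖ + 1 := by positivity
    have hnear0 : ∀ᶠ s in 𝓝[>] (0 : ℝ), ‖u s x₀‖ < ‖u₀‖ + 1 :=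
      hu.1.norm.eventually_lt_const (by linarith)
    filter_upwards [hbound (ε / (2 * (‖u₀‖ + 1))) (by positivity), hnear0] with s hs hs'
    have := hs (u s x₀) 0 hs'.le (by simpa using hC.le)
    have hz : taylorRemainder g x 0 = 0 := by simp [taylorRemainder]
    rw [smul_zero, hz, smul_zero, sub_zero, sub_zero] at this
    rw [dist_zero_right]
    refine this.trans_lt ?_
    calc ε / (2 * (‖u₀‖ + 1)) * ‖u s x₀‖ ≤ ε / (2 * (‖u₀‖ + 1)) * (‖u₀‖ + 1) := by gcongr
      _ = ε / 2 := by field_simp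
      _ < ε := half_lt_self hε
  · have : (fun p : ℝ × X × X => (p.1 ^ 3)⁻¹ • taylorRemainder g x (p.1 • u p.1 p.2.1) -
        (p.1 ^ 3)⁻¹ • taylorRemainder g x (p.1 • u p.1 p.2.2)) =o[𝓝[>] (0 : ℝ) ×ˢ 𝓝 (x₀, x₀)]
        fun p => u p.1 p.2.1 - u p.1 p.2.2 := by
      refine IsLittleO.of_bound fun ε hε => ?_
      rw [nhds_prod_eq]
      have t1 : Tendsto (fun p : ℝ × X × X => (p.1, p.2.1)) (𝓝[>] (0 : ℝ) ×ˢ (𝓝 x₀ ×ˢ 𝓝 x₀))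
          (𝓝[>] (0 : ℝ) ×ˢ 𝓝 x₀) := tendsto_fst.prodMk (tendsto_fst.comp tendsto_snd)
      have t2 : Tendsto (fun p : ℝ × X × X => (p.1, p.2.2)) (𝓝[>] (0 : ℝ) ×ˢ (𝓝 x₀ ×ˢ 𝓝 x₀))
          (𝓝[>] (0 : ℝ) ×ˢ 𝓝 x₀) := tendsto_fst.prodMk (tendsto_snd.comp tendsto_snd)
      filter_upwards [t1.eventually hnear, t2.eventually hnear, (hbound ε hε).prod_inl _]
        with p p1 p2 p3
      exact p3 _ _ p1.le p2.le
    simpa using this.trans_isBigO hu.isBigO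

/-- The cubic term of `g` at `x + s a v + s² w`, to leading order in `s`. -/
theorem hasStrictFDerivAlong_taylor_cubic (h0 : ∀ᶠ y in 𝓝 x, DifferentiableAt ℝ g y)
    (h1 : ∀ᶠ y in 𝓝 x, DifferentiableAt ℝ (fderiv ℝ g) y)
    (h2 : DifferentiableAt ℝ (fderiv ℝ (fderiv ℝ g)) x) (v : E) (p : ℝ × E) :
    HasStrictFDerivAlong (𝓝[>] (0 : ℝ))
      (fun s (y : ℝ × E) => (s ^ 3)⁻¹ • (g (x + s • (y.1 • v + s • y.2)) - g x -
        (s * y.1) • fderiv ℝ g x v - s ^ 2 • (fderiv ℝ g x y.2 +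
          (y.1 ^ 2 / 2) • fderiv ℝ (fderiv ℝ g) x v v)))
      ((ContinuousLinearMap.fst ℝ ℝ E).smulRight (fderiv ℝ (fderiv ℝ g) x v p.2 +
          (p.1 ^ 2 / 2) • fderiv ℝ (fderiv ℝ (fderiv ℝ g)) x v v v) +
        p.1 • (fderiv ℝ (fderiv ℝ g) x v).comp (ContinuousLinearMap.snd ℝ ℝ E)) p
      (p.1 • fderiv ℝ (fderiv ℝ g) x v p.2 +
        (p.1 ^ 3 / 6) • fderiv ℝ (fderiv ℝ (fderiv ℝ g)) x v v v) := by
  set H := fderiv ℝ g x with hH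
  set T := fderiv ℝ (fderiv ℝ g) x with hT
  set S := fderiv ℝ (fderiv ℝ (fderiv ℝ g)) x with hS
  have hsid : Tendsto (fun s : ℝ => s) (𝓝[>] 0) (𝓝 0) := tendsto_id.mono_left nhdsWithin_le_nhds
  have hfst : HasStrictFDerivAlong (𝓝[>] (0 : ℝ)) (fun (_ : ℝ) (x : ℝ × E) => x.1)
      (ContinuousLinearMap.fst ℝ ℝ E) p p.1 :=
    .of_strict (ContinuousLinearMap.fst ℝ ℝ E).hasStrictFDerivAt
  have hsnd : HasStrictFDerivAlong (𝓝[>] (0 : ℝ)) (fun (_ : ℝ) (x : ℝ × E) => x.2)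
      (ContinuousLinearMap.snd ℝ ℝ E) p p.2 :=
    .of_strict (ContinuousLinearMap.snd ℝ ℝ E).hasStrictFDerivAt
  have hu : HasStrictFDerivAlong (𝓝[>] (0 : ℝ)) (fun s (y : ℝ × E) => y.1 • v + s • y.2)
      ((ContinuousLinearMap.fst ℝ ℝ E).smulRight v) p (p.1 • v) :=
    ((hfst.smul (.of_tendsto tendsto_const_nhds : HasStrictFDerivAlong _ (fun _ _ => v) 0 p v)).add
      (.tendsto_smul hsid hsnd)).congr_deriv (fun y => by simp) (by simp)
  have hcub : ∀ z : E, HasStrictFDerivAt (fun y => S y y y)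
      (S z z + (S z + S.flip z).flip z) z := by
    intro z
    have e3 : HasStrictFDerivAt (fun y => S y y) (S z + S.flip z) z := by
      simpa using S.hasStrictFDerivAt.clm_apply (hasStrictFDerivAt_id z)
    simpa using e3.clm_apply (hasStrictFDerivAt_id z)
  have hquad : ∀ z : E, HasStrictFDerivAt (fun y => T y y) (T z + T.flip z) z := fun z => by
    simpa using T.hasStrictFDerivAt.clm_apply (hasStrictFDerivAt_id z)
  have hmain := (((hfst.smul (hsnd.clm (T v))).add
    (.tendsto_smul (hsid.div_const 2) (HasStrictFDerivAlong.comp_strict (hquad p.2) hsnd))).add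
    (.tendsto_smul (tendsto_const_nhds (x := (1 / 6 : ℝ)))
      (HasStrictFDerivAlong.comp_strict (hcub (p.1 • v)) hu))).add
    (hasStrictFDerivAlong_taylorRemainder h0 h1 h2 hu)
  refine (hmain.congr_deriv ?_ ?_).congr' ?_
  · intro y
    simp only [add_apply, FunLike.coe_smul, Pi.smul_apply, ContinuousLinearMap.comp_apply,
      ContinuousLinearMap.smulRight_apply, ContinuousLinearMap.coe_fst',
      ContinuousLinearMap.coe_snd', ContinuousLinearMap.flip_apply, map_smul, zero_apply]
    module
  · simp only [map_smul, FunLike.coe_smul, Pi.smul_apply]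
    module
  · filter_upwards [self_mem_nhdsWithin] with s hs y
    have hs : s ≠ 0 := (show 0 < s from hs).ne'
    have hsym : T y.2 v = T v y.2 := (eventually_fderiv_fderiv_symm h0 h1).self_of_nhds y.2 v
    rw [eq_inv_smul_iff₀ (pow_ne_zero 3 hs), smul_add, smul_inv_smul₀ (pow_ne_zero 3 hs),
      taylorRemainder, ← hH, ← hT, ← hS]
    have e1 : H (s • (y.1 • v + s • y.2)) = (s * y.1) • H v + s ^ 2 • H y.2 := by
      simp only [map_smul, map_add]; module
    have e2 : T (s • (y.1 • v + s • y.2)) (s • (y.1 • v + s • y.2)) =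
        (s ^ 2 * y.1 ^ 2) • T v v + (2 * s ^ 3 * y.1) • T v y.2 + s ^ 4 • T y.2 y.2 := by
      simp only [map_smul, map_add, add_apply, FunLike.coe_smul, Pi.smul_apply, hsym]; module
    rw [e1, e2]
    generalize y.1 • v + s • y.2 = u
    simp only [map_smul, FunLike.coe_smul, Pi.smul_apply]
    module

end Taylor

/-! ### The Hessian transversally to its leading eigenvector -/

section LinearAlgebra

variable {E : Type*} [NormedAddCommGroup E] [InnerProductSpace ℝ E]

/-- At the step size `2 / lam`, the linearized gradient step contracts the orthogonal complement of
the leading eigenvector: there, all eigenvalues `μ` of the Hessian satisfy `0 < μ < lam`, hence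
`|1 - 2 μ / lam| < 1`. -/
theorem exists_norm_sub_smul_le_of_orthogonal [FiniteDimensional ℝ E] {H : E →L[ℝ] E}
    (hsymm : H.toLinearMap.IsSymmetric)
    (hpos : ∀ w : E, w ≠ 0 → 0 < inner ℝ w (H w)) {lam : ℝ} {v : E}
    (hv : Module.End.HasEigenvector H.toLinearMap lam v)
    (hmax : ∀ μ : ℝ, Module.End.HasEigenvalue H.toLinearMap μ → μ ≤ lam)
    (hsimple : Module.finrank ℝ (Module.End.eigenspace H.toLinearMap lam) = 1) :
    ∃ m : ℝ, 0 ≤ m ∧ m < 1 ∧ ∀ w, inner ℝ v w = 0 → ‖w - (2 / lam) • H w‖ ≤ m * ‖w‖ := by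
  have hposE : ∀ {μ : ℝ} {u : E}, Module.End.HasEigenvector H.toLinearMap μ u → 0 < μ := by
    intro μ u hu
    have h1 := hpos u hu.2
    have h2 : H u = μ • u := hu.apply_eq_smul
    rw [h2, inner_smul_right] at h1
    exact pos_of_mul_pos_left h1 real_inner_self_nonneg
  have hlam : 0 < lam := hposE hv
  let b := hsymm.eigenvectorBasis rfl
  let μ := hsymm.eigenvalues rfl
  have hb : ∀ i, Module.End.HasEigenvector H.toLinearMap (μ i) (b i) :=
    hsymm.hasEigenvector_eigenvectorBasis rfl
  have habs : ∀ i, μ i ≠ lam → |1 - 2 / lam * μ i| < 1 := by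
    intro i hi
    have h1 : 0 < μ i := hposE (hb i)
    have h2 : μ i < lam :=
      lt_of_le_of_ne (hmax _ (Module.End.hasEigenvalue_of_hasEigenvector (hb i))) hi
    have h3 : 2 / lam * μ i < 2 := by rw [div_mul_eq_mul_div, div_lt_iff₀ hlam]; linarith
    have h4 : 0 < 2 / lam * μ i := by positivity
    rw [abs_lt]; constructor <;> linarith
  have hev : ∀ᶠ m in 𝓝[<] (1 : ℝ), ∀ i, μ i ≠ lam → |1 - 2 / lam * μ i| ≤ m := by
    refine eventually_all.2 fun i => ?_
    by_cases hi : μ i = lam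
    · exact .of_forall fun m h => absurd hi h
    · filter_upwards [mem_nhdsWithin_of_mem_nhds (Ioi_mem_nhds (habs i hi))] with m hm _
      exact (show _ < m from hm).le
  have hev0 : ∀ᶠ m in 𝓝[<] (1 : ℝ), 0 < m :=
    mem_nhdsWithin_of_mem_nhds (Ioi_mem_nhds zero_lt_one)
  obtain ⟨m, hm, hm0, hm1⟩ := (hev.and (hev0.and self_mem_nhdsWithin)).exists
  refine ⟨m, hm0.le, hm1, fun w hw => ?_⟩
  refine le_of_sq_le_sq ?_ (by positivity)
  rw [mul_pow, ← b.sum_sq_norm_inner_right w, ← b.sum_sq_norm_inner_right (w - (2 / lam) • H w),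
    Finset.mul_sum]
  refine Finset.sum_le_sum fun i _ => ?_
  have h1 : inner ℝ (b i) (H w) = μ i * inner ℝ (b i) w := by
    have h2 : H (b i) = μ i • b i := (hb i).apply_eq_smul
    rw [← real_inner_smul_left, ← h2]
    exact (hsymm (b i) w).symm
  rw [inner_sub_right, inner_smul_right, h1]
  by_cases hi : μ i = lam
  · -- the eigenvalue is simple, so that `b i` is parallel to `v`
    have hbi : b i ∈ Module.End.eigenspace H.toLinearMap lam := hi ▸ (hb i).1
    obtain ⟨c, hc⟩ := (finrank_eq_one_iff_of_nonzero'
      (⟨v, hv.1⟩ : Module.End.eigenspace H.toLinearMap lam)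
      (fun h => hv.2 (congrArg Subtype.val h))).1 hsimple ⟨b i, hbi⟩
    have hc' : c • v = b i := congrArg Subtype.val hc
    have : inner ℝ (b i) w = 0 := by rw [← hc', inner_smul_left, hw, mul_zero]
    simp [this]
  · have : inner ℝ (b i) w - 2 / lam * (μ i * inner ℝ (b i) w) =
        (1 - 2 / lam * μ i) * inner ℝ (b i) w := by ring
    rw [this, norm_mul, mul_pow]
    gcongr
    exact hm i hi

/-- The coordinate of `z` along `v`, for the decomposition of the space into the line spanned by
`v` and its orthogonal complement. -/
noncomputable def coordAlong (v : E) : E →L[ℝ] ℝ := (‖v‖ ^ 2)⁻¹ • innerSL ℝ v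

theorem coordAlong_apply (v z : E) : coordAlong v z = inner ℝ v z / ‖v‖ ^ 2 := by
  simp [coordAlong, div_eq_inv_mul]

theorem coordAlong_self {v : E} (hv : v ≠ 0) : coordAlong v v = 1 := by
  rw [coordAlong_apply, real_inner_self_eq_norm_sq, div_self (by simpa using hv)]

theorem coordAlong_coe (v : E) (w : (ℝ ∙ v)ᗮ) : coordAlong v (w : E) = 0 := by
  rw [coordAlong_apply, Submodule.mem_orthogonal_singleton_iff_inner_right.1 w.2, zero_div]

theorem coordAlong_smul_add (v z : E) :
    coordAlong v z • v + (((ℝ ∙ v)ᗮ.orthogonalProjectionOnto z : (ℝ ∙ v)ᗮ) : E) = z := by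
  have h : (((ℝ ∙ v)ᗮ.orthogonalProjectionOnto z : (ℝ ∙ v)ᗮ) : E) = z - (ℝ ∙ v).starProjection z :=
    Submodule.starProjection_orthogonal_val z
  rw [h, Submodule.starProjection_singleton, coordAlong_apply]
  exact add_sub_cancel _ _

end LinearAlgebra

/-! ### Two-cycles of the gradient step -/

section GradientStep

variable {E : Type*} [NormedAddCommGroup E] [InnerProductSpace ℝ E]

/-- The coordinates `(a, w) ↦ x + s a v + s² w` around `x`, where `w` is orthogonal to `v`: the
distance to the center manifold is measured in the scale of its curvature. -/
noncomputable def scaledCoord {v : E} (hv : v ≠ 0) (x : E) {s : ℝ} (hs : s ≠ 0) :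
    ℝ × (ℝ ∙ v)ᗮ ≃ₜ E where
  toFun y := x + s • (y.1 • v + s • (y.2 : E))
  invFun z := (s⁻¹ * coordAlong v (z - x), (s ^ 2)⁻¹ • (ℝ ∙ v)ᗮ.orthogonalProjectionOnto (z - x))
  left_inv y := by
    have h1 : (ℝ ∙ v)ᗮ.orthogonalProjectionOnto v = 0 :=
      Submodule.orthogonalProjectionOnto_orthogonalComplement_singleton_eq_zero v
    ext
    · simp [coordAlong_self hv, coordAlong_coe, hs]
    · simp [h1, smul_smul]
      field_simp
      simp
  right_inv z := by
    conv_rhs => rw [← add_sub_cancel x z, ← coordAlong_smul_add v (z - x)]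
    simp only [smul_add, smul_smul, Submodule.coe_smul]
    congr 3
    · field_simp
    · field_simp
      rw [one_smul]
  continuous_toFun := by fun_prop
  continuous_invFun := by fun_prop

/-- The flip bifurcation of gradient descent. With `H`, `T`, `S` the first three derivatives of the
gradient `g` at `x` and `H u = T v v`, the number `⟪v, S v v v⟫ - 3 ⟪T v v, u⟫` is, up to a positive
factor, the cubic coefficient of the second iterate on the center manifold; if it is negative, the
flip is supercritical. The parameter `s` of the rescaled coordinates is tied to the step size `η` by
`η lam = 2 + k s²`. -/
theorem eventually_exists_isStableTwoCycle [CompleteSpace E] {g : E → E} {x v u : E} {lam : ℝ}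
    (h0 : ∀ᶠ y in 𝓝 x, DifferentiableAt ℝ g y)
    (h1 : ∀ᶠ y in 𝓝 x, DifferentiableAt ℝ (fderiv ℝ g) y)
    (h2 : DifferentiableAt ℝ (fderiv ℝ (fderiv ℝ g)) x)
    (hgx : g x = 0) (hv : v ≠ 0) (hlam : 0 < lam) (hHv : fderiv ℝ g x v = lam • v)
    (hH : ∀ z, inner ℝ v (fderiv ℝ g x z) = lam * inner ℝ v z)
    {m : ℝ} (hm0 : 0 ≤ m) (hm1 : m < 1)
    (hm : ∀ w, inner ℝ v w = 0 → ‖w - (2 / lam) • fderiv ℝ g x w‖ ≤ m * ‖w‖)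
    (hu : fderiv ℝ g x u = fderiv ℝ (fderiv ℝ g) x v v)
    (hT : ∀ w, inner ℝ v (fderiv ℝ (fderiv ℝ g) x v w) =
      inner ℝ (fderiv ℝ (fderiv ℝ g) x v v) w)
    (hD : inner ℝ v (fderiv ℝ (fderiv ℝ (fderiv ℝ g)) x v v v) <
      3 * inner ℝ (fderiv ℝ (fderiv ℝ g) x v v) u)
    {U : Set E} (hU : U ∈ 𝓝 x) :
    ∀ᶠ η in 𝓝[>] (2 / lam), ∃ p ∈ U, ∃ q ∈ U, IsStableTwoCycle (fun y => y - η • g y) p q := by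
  set H := fderiv ℝ g x with hHdef
  set T := fderiv ℝ (fderiv ℝ g) x with hTdef
  set S := fderiv ℝ (fderiv ℝ (fderiv ℝ g)) x with hSdef
  let P := (ℝ ∙ v)ᗮ.orthogonalProjectionOnto
  let φ := coordAlong v
  let ι := (ℝ ∙ v)ᗮ.subtypeL
  have hvn : 0 < ‖v‖ ^ 2 := by positivity
  have hdec : ∀ z, φ z • v + ((P z : (ℝ ∙ v)ᗮ) : E) = z := coordAlong_smul_add v
  have hPv : P v = 0 := Submodule.orthogonalProjectionOnto_orthogonalComplement_singleton_eq_zero v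
  have hφw : ∀ w : (ℝ ∙ v)ᗮ, φ (w : E) = 0 := coordAlong_coe v
  have hφH : ∀ z, φ (H z) = lam * φ z := fun z => by
    simp only [φ, coordAlong_apply, hH]; ring
  have hPH : ∀ w : (ℝ ∙ v)ᗮ, ((P (H w) : (ℝ ∙ v)ᗮ) : E) = H w := fun w => by
    have := hdec (H w)
    rwa [hφH, hφw, mul_zero, zero_smul, zero_add] at this
  -- the coefficients of the normal form
  set τ := φ (T v v) with hτ
  set h : (ℝ ∙ v)ᗮ := P u with hh
  let ℓ : (ℝ ∙ v)ᗮ →L[ℝ] ℝ := (2 / lam) • (φ ∘L T v ∘L ι)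
  set β := φ (S v v v) / (3 * lam) with hβ
  let M : (ℝ ∙ v)ᗮ →L[ℝ] (ℝ ∙ v)ᗮ := ContinuousLinearMap.id ℝ _ - (2 / lam) • (P ∘L H ∘L ι)
  set k := ℓ h / 2 - β + (τ / lam) ^ 2 with hk
  have hMn : ‖M‖ < 1 := by
    refine lt_of_le_of_lt (M.opNorm_le_bound hm0 fun w => ?_) hm1
    have hw := hm w (Submodule.mem_orthogonal_singleton_iff_inner_right.1 w.2)
    have : ((M w : (ℝ ∙ v)ᗮ) : E) = w - (2 / lam) • H w := by
      simp [M, ι, hPH]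
    change ‖((M w : (ℝ ∙ v)ᗮ) : E)‖ ≤ m * ‖(w : E)‖
    rw [this]
    exact hw
  have hφu : τ = lam * φ u := by rw [hτ, ← hu, hφH]
  have hPT : P (T v v) = P (H h) := by
    rw [← hu]
    conv_lhs => rw [← hdec u]
    rw [map_add, map_smul, hHv, map_add, map_smul, map_smul, hPv]
    simp [hh]
  have hMh : h - M h = (2 / lam) • P (T v v) := by
    rw [hPT]; simp [M, ι]
  have hk0 : 0 < k := by
    have e1 : ℓ h = 2 / lam * (inner ℝ (T v v) h / ‖v‖ ^ 2) := by
      simp only [ℓ, ι, FunLike.coe_smul, Pi.smul_apply, ContinuousLinearMap.comp_apply,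
        Submodule.subtypeL_apply, smul_eq_mul, φ, coordAlong_apply, hT]
    have e2 : inner ℝ (T v v) u = τ ^ 2 / lam * ‖v‖ ^ 2 + inner ℝ (T v v) h := by
      conv_lhs => rw [← hdec u]
      rw [inner_add_right, inner_smul_right, real_inner_comm]
      have : inner ℝ v (T v v) = τ * ‖v‖ ^ 2 := by
        rw [hτ]; simp only [φ, coordAlong_apply]; field_simp
      rw [this, hφu]
      field_simp
      rfl
    have e3 : k = (3 * inner ℝ (T v v) u - inner ℝ v (S v v v)) / (3 * lam * ‖v‖ ^ 2) := by
      rw [hk, e1, e2, hβ]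
      simp only [φ, coordAlong_apply]
      field_simp
      ring
    rw [e3]
    have : 0 < 3 * inner ℝ (T v v) u - inner ℝ v (S v v v) := by linarith
    positivity
  -- the rescaled gradient step
  let cub : ℝ → ℝ × E → E := fun s y => (s ^ 3)⁻¹ • (g (x + s • (y.1 • v + s • y.2)) - g x -
    (s * y.1) • H v - s ^ 2 • (H y.2 + (y.1 ^ 2 / 2) • T v v))
  let inc : ℝ × (ℝ ∙ v)ᗮ →L[ℝ] ℝ × E := (ContinuousLinearMap.fst ℝ ℝ _).prod
    (ι ∘L ContinuousLinearMap.snd ℝ ℝ _)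
  let step : ℝ → ℝ := fun s => (2 + k * s ^ 2) / lam
  let X : ℝ → ℝ × (ℝ ∙ v)ᗮ → ℝ := fun s y =>
    k * y.1 + s * (k * τ / (2 * lam)) * y.1 ^ 2 + step s * φ (cub s (inc y))
  let Y : ℝ → ℝ × (ℝ ∙ v)ᗮ → (ℝ ∙ v)ᗮ := fun s y =>
    y.2 - step s • (P (H y.2) + (y.1 ^ 2 / 2) • P (T v v) + s • P (cub s (inc y)))
  let G : ℝ → ℝ × (ℝ ∙ v)ᗮ → ℝ × (ℝ ∙ v)ᗮ := fun s y =>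
    (-y.1 - s * (τ / lam * y.1 ^ 2 + s * X s y), Y s y)
  have hconj : ∀ (s : ℝ) (hs : s ≠ 0) (y : ℝ × (ℝ ∙ v)ᗮ),
      scaledCoord hv x hs y - step s • g (scaledCoord hv x hs y) = scaledCoord hv x hs (G s y) := by
    intro s hs y
    have e1 : g (scaledCoord hv x hs y) = (s * y.1) • (lam • v) +
        s ^ 2 • (((P (H y.2) : (ℝ ∙ v)ᗮ) : E) +
          (y.1 ^ 2 / 2) • (τ • v + ((P (T v v) : (ℝ ∙ v)ᗮ) : E))) +
        s ^ 3 • (φ (cub s (inc y)) • v + ((P (cub s (inc y)) : (ℝ ∙ v)ᗮ) : E)) := by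
      rw [hdec, hdec, hPH, ← hHv]
      simp only [cub, smul_inv_smul₀ (pow_ne_zero 3 hs), hgx, sub_zero]
      change _ = _ + _ + (g (scaledCoord hv x hs y) - _ - _)
      simp only [inc, ι]
      simp
    rw [e1]
    change x + s • (y.1 • v + s • (y.2 : E)) - _ = x + s • ((G s y).1 • v + s • ((G s y).2 : E))
    simp only [G, X, Y, Submodule.coe_sub, Submodule.coe_smul, Submodule.coe_add]
    generalize φ (cub s (inc y)) = c
    generalize ((P (cub s (inc y)) : (ℝ ∙ v)ᗮ) : E) = d
    have e2 : step s * lam = 2 + k * s ^ 2 := div_mul_cancel₀ _ hlam.ne'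
    have e3 : step s * τ / 2 = τ / lam + s ^ 2 * (k * τ / (2 * lam)) := by
      simp only [step]; field_simp
    generalize step s = b at e2 e3 ⊢
    match_scalars
    · ring
    · linear_combination (-s * y.1) * e2 - s ^ 2 * y.1 ^ 2 * e3
    · ring
    · ring
    · ring
    · ring
  have hsid : Tendsto (fun s : ℝ => s) (𝓝[>] 0) (𝓝 0) := tendsto_id.mono_left nhdsWithin_le_nhds
  have hstep : Tendsto step (𝓝[>] 0) (𝓝 (2 / lam)) := by
    have : Tendsto step (𝓝 0) (𝓝 (step 0)) := Continuous.tendsto (by fun_prop) 0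
    simpa [step] using this.mono_left nhdsWithin_le_nhds
  have hfst : ∀ y : ℝ × (ℝ ∙ v)ᗮ, HasStrictFDerivAlong (𝓝[>] (0 : ℝ)) (fun _ y => y.1)
      (ContinuousLinearMap.fst ℝ ℝ (ℝ ∙ v)ᗮ) y y.1 := fun y =>
    .of_strict hasStrictFDerivAt_fst
  have hsnd : ∀ y : ℝ × (ℝ ∙ v)ᗮ, HasStrictFDerivAlong (𝓝[>] (0 : ℝ)) (fun _ y => y.2)
      (ContinuousLinearMap.snd ℝ ℝ (ℝ ∙ v)ᗮ) y y.2 := fun y =>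
    .of_strict hasStrictFDerivAt_snd
  have hcub := fun y : ℝ × (ℝ ∙ v)ᗮ =>
    (hasStrictFDerivAlong_taylor_cubic h0 h1 h2 v (inc y)).comp (.of_strict inc.hasStrictFDerivAt)
  have hX : ∀ y, HasStrictFDerivAlong (𝓝[>] (0 : ℝ)) X
      ((k + ℓ y.2 + 3 * β * y.1 ^ 2) • ContinuousLinearMap.fst ℝ ℝ _ +
        y.1 • ℓ.comp (ContinuousLinearMap.snd ℝ ℝ _)) y
      (k * y.1 + y.1 * ℓ y.2 + β * y.1 ^ 3) := fun y =>
    ((((HasStrictFDerivAlong.tendsto_smul (tendsto_const_nhds (x := k)) (hfst y)).add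
      (.tendsto_smul (hsid.mul_const (k * τ / (2 * lam))) ((hfst y).smul (hfst y)))).add
      (.tendsto_smul hstep (.clm φ (hcub y)))).congr'
      (.of_forall fun s y => by
        simp only [X, cub, smul_eq_mul]
        ring)).congr_deriv
      (fun z => by
        simp [inc, ℓ, ι, hβ]
        field_simp
        ring)
      (by
        simp [inc, ℓ, ι, hβ]
        field_simp
        ring)
  have hY : ∀ y, HasStrictFDerivAlong (𝓝[>] (0 : ℝ)) (fun s y => (G s y).2)
      (M.comp (ContinuousLinearMap.snd ℝ ℝ _) -
        y.1 • (ContinuousLinearMap.fst ℝ ℝ _).smulRight (h - M h)) y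
      (M y.2 - (y.1 ^ 2 / 2) • (h - M h)) := fun y =>
    (((hsnd y).sub (.tendsto_smul hstep (((hsnd y).clm (P ∘L H ∘L ι)).add
      (.tendsto_smul (tendsto_const_nhds (x := (1 / 2 : ℝ))) (((hfst y).smul (hfst y)).smul
        (.of_tendsto (tendsto_const_nhds (x := P (T v v)))) |>.add
        (.tendsto_smul (hsid.const_mul 2) (.clm P (hcub y)))))))).congr'
      (.of_forall fun s y => by
        simp only [G, Y, cub, ι, smul_eq_mul, ContinuousLinearMap.comp_apply,
          Submodule.subtypeL_apply]
        module)).congr_deriv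
      (fun z => by
        rw [hMh]
        simp [inc, ι, M]
        module)
      (by
        rw [hMh]
        simp [inc, ι, M]
        module)
  -- the cycles stay in any prescribed neighbourhood of `x`
  have hπ : ∀ y₀ : ℝ × (ℝ ∙ v)ᗮ, Tendsto (fun z : ℝ × ℝ × (ℝ ∙ v)ᗮ =>
      x + z.1 • (z.2.1 • v + z.1 • (z.2.2 : E))) (𝓝[>] 0 ×ˢ 𝓝 y₀) (𝓝 x) := by
    intro y₀
    have hc : Continuous (fun z : ℝ × ℝ × (ℝ ∙ v)ᗮ =>
      x + z.1 • (z.2.1 • v + z.1 • (z.2.2 : E))) := by fun_prop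
    have := hc.tendsto (0, y₀)
    rw [nhds_prod_eq] at this
    simpa using this.mono_left (prod_mono_left _ nhdsWithin_le_nhds)
  obtain ⟨pa, ha, pb, hb, hab⟩ := eventually_prod_iff.1
    ((hπ (1, -(1 / 2 : ℝ) • h)).eventually (inter_mem hU h0))
  obtain ⟨pa', ha', pb', hb', hab'⟩ := eventually_prod_iff.1
    ((hπ (-1, -(1 / 2 : ℝ) • h)).eventually (inter_mem hU h0))
  have hpos : ∀ᶠ y : ℝ × (ℝ ∙ v)ᗮ in 𝓝 (1, -(1 / 2 : ℝ) • h), 0 < y.1 :=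
    continuous_fst.continuousAt.eventually_const_lt (by norm_num)
  have hneg : ∀ᶠ y : ℝ × (ℝ ∙ v)ᗮ in 𝓝 (-1, -(1 / 2 : ℝ) • h), y.1 < 0 :=
    continuous_fst.continuousAt.eventually_lt_const (by norm_num)
  have hflip := exists_stable_twoCycle_of_flip (F := G) (fun s y => rfl) hX hY hk hk0 hMn
    (hb.and hpos) (hb'.and hneg)
  have hcyc : ∀ᶠ s in 𝓝[>] (0 : ℝ), ∃ p ∈ U, ∃ q ∈ U,
      IsStableTwoCycle (fun y => y - step s • g y) p q := by
    filter_upwards [hflip, ha, ha', self_mem_nhdsWithin]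
      with s ⟨p, hp, hGp, hfix, hst⟩ has has' hs
    have hs : s ≠ 0 := (show 0 < s from hs).ne'
    have hpU : scaledCoord hv x hs p ∈ U ∩ {y | DifferentiableAt ℝ g y} := hab has hp.1
    have hqU : scaledCoord hv x hs (G s p) ∈ U ∩ {y | DifferentiableAt ℝ g y} := hab' has' hGp.1
    refine ⟨_, hpU.1, _, hqU.1, isStableTwoCycle_of_conj (scaledCoord hv x hs) (hconj s hs)
      (fun heq => ?_) hfix hst ?_ ?_⟩
    · have h3 : (G s p).1 < 0 := hGp.2
      rw [← heq] at h3
      exact lt_asymm h3 hp.2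
    · exact continuousAt_id.sub (hpU.2.continuousAt.const_smul _)
    · exact continuousAt_id.sub (hqU.2.continuousAt.const_smul _)
  have hparam : Tendsto (fun η : ℝ => √((η * lam - 2) / k)) (𝓝[>] (2 / lam)) (𝓝[>] 0) := by
    refine tendsto_nhdsWithin_iff.2 ⟨?_, ?_⟩
    · have hc : Continuous (fun η : ℝ => √((η * lam - 2) / k)) := by fun_prop
      have := (hc.tendsto (2 / lam)).mono_left (nhdsWithin_le_nhds (s := Set.Ioi (2 / lam)))
      simpa [div_mul_cancel₀ _ hlam.ne'] using this
    · filter_upwards [self_mem_nhdsWithin] with η hη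
      have : 2 < η * lam := (div_lt_iff₀ hlam).1 hη
      exact Real.sqrt_pos.2 (div_pos (by linarith) hk0)
  filter_upwards [hparam.eventually hcyc, self_mem_nhdsWithin] with η hη hη'
  have h3 : 2 < η * lam := (div_lt_iff₀ hlam).1 hη'
  have h4 : step (√((η * lam - 2) / k)) = η := by
    simp only [step]
    rw [Real.sq_sqrt (div_nonneg (by linarith) hk0.le)]
    field_simp
    ring
  rwa [h4] at hη

end GradientStep

/-! ### Derivatives of the objective and of its gradient -/

section Derivatives

variable {E F F' : Type*} [NormedAddCommGroup E] [NormedSpace ℝ E]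
  [NormedAddCommGroup F] [NormedSpace ℝ F] [NormedAddCommGroup F'] [NormedSpace ℝ F']

theorem differentiableAt_iteratedFDeriv_succ {f : E → F} {k : ℕ} {x : E} :
    DifferentiableAt ℝ (iteratedFDeriv ℝ (k + 1) f) x ↔
      DifferentiableAt ℝ (iteratedFDeriv ℝ k (fderiv ℝ f)) x := by
  have : iteratedFDeriv ℝ (k + 1) f = (continuousMultilinearCurryRightEquiv' ℝ k E F).symm ∘
      iteratedFDeriv ℝ k (fderiv ℝ f) := funext fun _ => iteratedFDeriv_succ_eq_comp_right
  rw [this]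
  exact LinearIsometryEquiv.comp_differentiableAt_iff (𝕜 := ℝ) (G := E)
    (E := ContinuousMultilinearMap ℝ (fun _ : Fin k => E) (E →L[ℝ] F))
    (F := ContinuousMultilinearMap ℝ (fun _ : Fin (k + 1) => E) F)
    (continuousMultilinearCurryRightEquiv' ℝ k E F).symm

theorem differentiableAt_iteratedFDeriv_zero {f : E → F} {x : E} :
    DifferentiableAt ℝ (iteratedFDeriv ℝ 0 f) x ↔ DifferentiableAt ℝ f x := by
  rw [iteratedFDeriv_zero_eq_comp, LinearIsometryEquiv.comp_differentiableAt_iff]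

/-- Four times differentiability in terms of iterated Fréchet derivatives. -/
theorem TimesDifferentiableAt.fderiv_four {L : E → ℝ} {x : E} (h : TimesDifferentiableAt 4 L x) :
    (∀ᶠ y in 𝓝 x, DifferentiableAt ℝ L y) ∧
      (∀ᶠ y in 𝓝 x, DifferentiableAt ℝ (fderiv ℝ L) y) ∧
      (∀ᶠ y in 𝓝 x, DifferentiableAt ℝ (fderiv ℝ (fderiv ℝ L)) y) ∧
      DifferentiableAt ℝ (fderiv ℝ (fderiv ℝ (fderiv ℝ L))) x := by
  have h0 := h.1 0 (by norm_num)
  have h1 := h.1 1 (by norm_num)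
  have h2 := h.1 2 (by norm_num)
  have h3 := h.2 3 (by norm_num)
  simp only [differentiableAt_iteratedFDeriv_succ, differentiableAt_iteratedFDeriv_zero]
    at h0 h1 h2 h3
  exact ⟨h0, h1, h2, h3⟩

theorem fderiv_eventuallyEq_compL {f : E → F'} {f₀ : E → F} {A : F →L[ℝ] F'} {x : E}
    (hf : f =ᶠ[𝓝 x] fun y => A (f₀ y)) (hd : ∀ᶠ y in 𝓝 x, DifferentiableAt ℝ f₀ y) :
    fderiv ℝ f =ᶠ[𝓝 x] fun y => ContinuousLinearMap.compL ℝ E F F' A (fderiv ℝ f₀ y) := by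
  filter_upwards [hf.eventuallyEq_nhds, hd] with y hy hdy
  rw [hy.fderiv_eq]
  exact (A.hasFDerivAt.comp y hdy.hasFDerivAt).fderiv

theorem derivForm_two (L : E → ℝ) (x v : E) :
    derivForm 2 L x v = fderiv ℝ (fderiv ℝ L) x v v := by
  simp [derivForm, iteratedFDeriv_succ_apply_right, Fin.init]

theorem derivForm_three (L : E → ℝ) (x v : E) :
    derivForm 3 L x v = fderiv ℝ (fderiv ℝ (fderiv ℝ L)) x v v v := by
  simp [derivForm, iteratedFDeriv_succ_apply_right, Fin.init]

theorem derivForm_four (L : E → ℝ) (x v : E) :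
    derivForm 4 L x v = fderiv ℝ (fderiv ℝ (fderiv ℝ (fderiv ℝ L))) x v v v v := by
  simp [derivForm, iteratedFDeriv_succ_apply_right, Fin.init]

end Derivatives

section Gradient

variable {E : Type*} [NormedAddCommGroup E] [InnerProductSpace ℝ E] [CompleteSpace E]

/-- The Riesz isomorphism as a linear map; over `ℝ` it is linear and not just conjugate linear. -/
noncomputable def rieszMap (E : Type*) [NormedAddCommGroup E] [InnerProductSpace ℝ E]
    [CompleteSpace E] : (E →L[ℝ] ℝ) →L[ℝ] E :=
  LinearMap.mkContinuous
    { toFun := (InnerProductSpace.toDual ℝ E).symm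
      map_add' := map_add _
      map_smul' := fun c ξ => by simp } 1 fun ξ => by simp

theorem inner_rieszMap (v : E) (ξ : E →L[ℝ] ℝ) : inner ℝ v (rieszMap E ξ) = ξ v := by
  rw [real_inner_comm]
  exact InnerProductSpace.toDual_symm_apply

/-- The derivatives of the gradient represent the derivatives of the objective. -/
theorem gradient_derivatives {L : E → ℝ} {x : E}
    (h1 : ∀ᶠ y in 𝓝 x, DifferentiableAt ℝ (fderiv ℝ L) y)
    (h2 : ∀ᶠ y in 𝓝 x, DifferentiableAt ℝ (fderiv ℝ (fderiv ℝ L)) y)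
    (h3 : DifferentiableAt ℝ (fderiv ℝ (fderiv ℝ (fderiv ℝ L))) x) :
    ((∀ᶠ y in 𝓝 x, DifferentiableAt ℝ (gradient L) y) ∧
      (∀ᶠ y in 𝓝 x, DifferentiableAt ℝ (fderiv ℝ (gradient L)) y) ∧
      DifferentiableAt ℝ (fderiv ℝ (fderiv ℝ (gradient L))) x) ∧
    (∀ a b, inner ℝ b (fderiv ℝ (gradient L) x a) = fderiv ℝ (fderiv ℝ L) x a b) ∧
    (∀ a b c, inner ℝ c (fderiv ℝ (fderiv ℝ (gradient L)) x a b) =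
      fderiv ℝ (fderiv ℝ (fderiv ℝ L)) x a b c) ∧
    ∀ a b c d, inner ℝ d (fderiv ℝ (fderiv ℝ (fderiv ℝ (gradient L))) x a b c) =
      fderiv ℝ (fderiv ℝ (fderiv ℝ (fderiv ℝ L))) x a b c d := by
  have e0 : gradient L =ᶠ[𝓝 x] fun y => rieszMap E (fderiv ℝ L y) := .of_eq rfl
  have e1 := fderiv_eventuallyEq_compL e0 h1
  have e2 := fderiv_eventuallyEq_compL e1 h2
  have e3 : fderiv ℝ (fderiv ℝ (fderiv ℝ (gradient L))) x = _ :=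
    e2.fderiv_eq.trans ((ContinuousLinearMap.hasFDerivAt _).comp x h3.hasFDerivAt).fderiv
  refine ⟨⟨?_, ?_, ?_⟩, fun a b => ?_, fun a b c => ?_, fun a b c d => ?_⟩
  · filter_upwards [e0.eventuallyEq_nhds, h1] with y hy hd
    exact ((ContinuousLinearMap.differentiableAt _).comp y hd).congr_of_eventuallyEq hy
  · filter_upwards [e1.eventuallyEq_nhds, h2] with y hy hd
    exact ((ContinuousLinearMap.differentiableAt _).comp y hd).congr_of_eventuallyEq hy
  · exact ((ContinuousLinearMap.differentiableAt _).comp x h3).congr_of_eventuallyEq e2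
  · rw [e1.self_of_nhds]; exact inner_rieszMap _ _
  · rw [e2.self_of_nhds]; exact inner_rieszMap _ _
  · rw [e3]; exact inner_rieszMap _ _

end Gradient

/-! ### The criterion for supercriticality -/

section Criterion

variable {d : ℕ} {L : EuclideanSpace ℝ (Fin d) → ℝ} {x v u : EuclideanSpace ℝ (Fin d)}
  {lam ηc : ℝ}

theorem EdgeOfStability.isSymmetric (h : EdgeOfStability L x v lam ηc) :
    (hessian L x).toLinearMap.IsSymmetric := by
  obtain ⟨h0, h1, h2, h3⟩ := h.differentiable.fderiv_four
  intro a b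
  have key := (gradient_derivatives h1 h2 h3).2.1
  have hs := second_derivative_symmetric_of_eventually (h0.mono fun _ hz => hz.hasFDerivAt)
    h1.self_of_nhds.hasFDerivAt a b
  change inner ℝ (fderiv ℝ (gradient L) x a) b = inner ℝ a (fderiv ℝ (gradient L) x b)
  rw [real_inner_comm, key, key, hs]

/-- The sufficient condition in its sharp form: with `H` the Hessian and `T v v` the vector
representing the third derivative applied to `v` twice, it reads
`D⁴L[v]⁴ < 3 ⟪T v v, H⁻¹ (T v v)⟫`. The condition involving only derivatives in the direction `v`
arises from projecting `T v v` onto `v`. -/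
theorem EdgeOfStability.hasStableTwoCycleNear (h : EdgeOfStability L x v lam ηc)
    (hu : hessian L x u = fderiv ℝ (hessian L) x v v)
    (hD : derivForm 4 L x v < 3 * inner ℝ (fderiv ℝ (hessian L) x v v) u) :
    HasStableTwoCycleNear L x ηc := by
  obtain ⟨h0, h1, h2, h3⟩ := h.differentiable.fderiv_four
  obtain ⟨⟨g0, g1, g2⟩, -, k3, k4⟩ := gradient_derivatives h1 h2 h3
  have hHv : hessian L x v = lam • v := h.eigenvector.apply_eq_smul
  have hv : v ≠ 0 := h.eigenvector.2
  have hlam : 0 < lam := by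
    have := h.hessian_pos v hv
    rw [hHv, inner_smul_right] at this
    exact pos_of_mul_pos_left this real_inner_self_nonneg
  have hηc : 2 / lam = ηc := by rw [h.edge, div_div_cancel₀ two_ne_zero]
  obtain ⟨m, hm0, hm1, hm⟩ := exists_norm_sub_smul_le_of_orthogonal h.isSymmetric h.hessian_pos
    h.eigenvector h.eigenvalue_max h.simple
  intro U hU
  rw [← hηc]
  refine eventually_exists_isStableTwoCycle (u := u) g0 g1 g2 ?_ hv hlam hHv (fun z => ?_)
    hm0 hm1 hm hu (fun w => ?_) ?_ hU
  · simp [gradient, h.isLocalMin.fderiv_eq_zero]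
  · have := h.isSymmetric v z
    change inner ℝ (hessian L x v) z = inner ℝ v (hessian L x z) at this
    rw [hHv, real_inner_smul_left] at this
    exact this.symm
  · rw [k3, real_inner_comm, k3]
    exact fderiv_fderiv_fderiv_symm_right h0 h1 h2.self_of_nhds v w v
  · rw [k4, ← derivForm_four]
    exact hD

theorem EdgeOfStability.hasStableTwoCycleNear_of_sharpDirectionCondition
    (h : EdgeOfStability L x v lam ηc) (hsharp : SharpDirectionCondition L x v) :
    HasStableTwoCycleNear L x ηc := by
  obtain ⟨h0, h1, h2, h3⟩ := h.differentiable.fderiv_four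
  obtain ⟨-, k2, k3, -⟩ := gradient_derivatives h1 h2 h3
  have hinj : Function.Injective (hessian L x).toLinearMap := by
    refine (injective_iff_map_eq_zero _).2 fun w hw => by_contra fun hne => ?_
    have := h.hessian_pos w hne
    rw [show hessian L x w = 0 from hw, inner_zero_right] at this
    exact lt_irrefl _ this
  obtain ⟨u, hu⟩ := LinearMap.injective_iff_surjective.1 hinj (fderiv ℝ (hessian L) x v v)
  have hu : hessian L x u = fderiv ℝ (hessian L) x v v := hu
  refine h.hasStableTwoCycleNear hu (lt_of_lt_of_le hsharp ?_)
  have e2 : derivForm 2 L x v = inner ℝ v (hessian L x v) := by rw [derivForm_two, ← k2]; rfl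
  have e3 : derivForm 3 L x v = inner ℝ v (hessian L x u) := by
    rw [derivForm_three, ← k3, hu]; rfl
  have hp : 0 < derivForm 2 L x v := e2 ▸ h.hessian_pos v h.eigenvector.2
  -- the Cauchy–Schwarz inequality for the scalar product defined by the Hessian
  have hcs : derivForm 3 L x v ^ 2 / derivForm 2 L x v ≤ inner ℝ (hessian L x u) u := by
    set c := derivForm 3 L x v / derivForm 2 L x v with hc
    have hnn : 0 ≤ inner ℝ (u - c • v) (hessian L x (u - c • v)) := by
      rcases eq_or_ne (u - c • v) 0 with h0 | h0
      · rw [h0]; simp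
      · exact (h.hessian_pos _ h0).le
    have hsy : inner ℝ u (hessian L x v) = derivForm 3 L x v := by
      rw [e3, real_inner_comm]
      exact h.isSymmetric v u
    rw [map_sub, map_smul, inner_sub_left, inner_sub_right, inner_sub_right, inner_smul_right,
      real_inner_smul_left, real_inner_smul_left, inner_smul_right, hsy, ← e3, ← e2] at hnn
    have hc2 : c * derivForm 2 L x v = derivForm 3 L x v := div_mul_cancel₀ _ hp.ne'
    have hc3 : derivForm 3 L x v ^ 2 / derivForm 2 L x v = c * derivForm 3 L x v := by
      rw [hc]; ring
    rw [hc3, real_inner_comm]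
    rw [hc2] at hnn
    linarith
  rw [← hu]
  linarith

end Criterion

/-! ### An objective violating the condition in the sharpest direction -/

section Example

/-- The objective `y₀² + y₀² y₁ + y₁² / 2`. It is quadratic along its sharpest direction `e₀`, but
the mixed cubic term makes the flip at the origin supercritical. -/
noncomputable def mixedCubic (y : EuclideanSpace ℝ (Fin 2)) : ℝ :=
  y 0 ^ 2 + y 0 ^ 2 * y 1 + y 1 ^ 2 / 2

/-- The Hessian `diag(2, 1)` of `mixedCubic` at the origin. -/
noncomputable def mixedCubicHessian : EuclideanSpace ℝ (Fin 2) →L[ℝ] EuclideanSpace ℝ (Fin 2) :=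
  (2 : ℝ) • (EuclideanSpace.proj 0 : EuclideanSpace ℝ (Fin 2) →L[ℝ] ℝ).smulRight
    (EuclideanSpace.single 0 1) +
  (EuclideanSpace.proj 1 : EuclideanSpace ℝ (Fin 2) →L[ℝ] ℝ).smulRight (EuclideanSpace.single 1 1)

/-- The (constant) third derivative of `mixedCubic`, as a bilinear map with values in the space. -/
noncomputable def mixedCubicThird :
    EuclideanSpace ℝ (Fin 2) →L[ℝ] EuclideanSpace ℝ (Fin 2) →L[ℝ] EuclideanSpace ℝ (Fin 2) :=
  let p : Fin 2 → EuclideanSpace ℝ (Fin 2) →L[ℝ] ℝ := fun i => EuclideanSpace.proj i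
  (2 : ℝ) • ((p 1).smulRight ((p 0).smulRight (EuclideanSpace.single 0 1)) +
    (p 0).smulRight ((p 1).smulRight (EuclideanSpace.single 0 1)) +
    (p 0).smulRight ((p 0).smulRight (EuclideanSpace.single 1 1)))

theorem mixedCubicHessian_apply (w : EuclideanSpace ℝ (Fin 2)) :
    mixedCubicHessian w = !₂[2 * w 0, w 1] := by
  ext i; fin_cases i <;> simp [mixedCubicHessian]

theorem mixedCubicThird_apply (y w : EuclideanSpace ℝ (Fin 2)) :
    mixedCubicThird y w = !₂[2 * (y 1 * w 0 + y 0 * w 1), 2 * (y 0 * w 0)] := by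
  have h : mixedCubicThird y w = (2 : ℝ) • (y 1 • w 0 • EuclideanSpace.single 0 1 +
      y 0 • w 1 • EuclideanSpace.single 0 1 + y 0 • w 0 • EuclideanSpace.single 1 1) := rfl
  rw [h]
  ext i; fin_cases i <;> simp [mul_add]

theorem gradient_mixedCubic :
    gradient mixedCubic = fun y => mixedCubicHessian y + (1 / 2 : ℝ) • mixedCubicThird y y := by
  refine gradient_eq fun y => ?_
  rw [hasGradientAt_iff_hasFDerivAt]
  have hp : ∀ i : Fin 2, HasFDerivAt (fun y : EuclideanSpace ℝ (Fin 2) => y i)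
      (EuclideanSpace.proj i : EuclideanSpace ℝ (Fin 2) →L[ℝ] ℝ) y := fun i =>
    (EuclideanSpace.proj i : EuclideanSpace ℝ (Fin 2) →L[ℝ] ℝ).hasFDerivAt
  have h := (((hp 0).pow 2).add (((hp 0).pow 2).mul (hp 1))).add (((hp 1).pow 2).mul_const (1 / 2))
  convert! h using 1
  · ext z; simp [mixedCubic]; ring
  · ext w
    simp [mixedCubicHessian_apply, mixedCubicThird_apply, InnerProductSpace.toDual_apply_apply,
      PiLp.inner_apply, Fin.sum_univ_two]
    ring

theorem hessian_mixedCubic :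
    hessian mixedCubic = fun y => mixedCubicHessian + mixedCubicThird y := by
  funext y
  rw [hessian, gradient_mixedCubic]
  have h : HasFDerivAt (fun y => mixedCubicThird y y)
      (mixedCubicThird y + mixedCubicThird.flip y) y := by
    simpa using mixedCubicThird.hasFDerivAt.clm_apply (hasFDerivAt_id y)
  have h' : HasFDerivAt (fun y => mixedCubicHessian y + (1 / 2 : ℝ) • mixedCubicThird y y)
      (mixedCubicHessian + (1 / 2 : ℝ) • (mixedCubicThird y + mixedCubicThird.flip y)) y :=
    mixedCubicHessian.hasFDerivAt.add (h.const_smul (1 / 2 : ℝ))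
  rw [h'.fderiv]
  ext w i
  fin_cases i <;> simp [mixedCubicHessian_apply, mixedCubicThird_apply] <;> ring

theorem fderiv_hessian_mixedCubic :
    fderiv ℝ (hessian mixedCubic) = fun _ => mixedCubicThird := by
  funext y
  rw [hessian_mixedCubic]
  exact (mixedCubicThird.hasFDerivAt.const_add mixedCubicHessian).fderiv

theorem timesDifferentiableAt_mixedCubic (y : EuclideanSpace ℝ (Fin 2)) :
    TimesDifferentiableAt 4 mixedCubic y := by
  have h : ContDiff ℝ 4 mixedCubic := by
    unfold mixedCubic; fun_prop
  have hd : ∀ k : ℕ, k < 4 → Differentiable ℝ (iteratedFDeriv ℝ k mixedCubic) := fun k hk =>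
    h.differentiable_iteratedFDeriv (by exact_mod_cast hk)
  exact ⟨fun k hk => .of_forall (hd k (by lia)), fun k hk => hd k hk y⟩

theorem edgeOfStability_mixedCubic :
    EdgeOfStability mixedCubic 0 (EuclideanSpace.single 0 1) 2 1 := by
  have hH : hessian mixedCubic 0 = mixedCubicHessian := by rw [hessian_mixedCubic]; simp
  have hvec : Module.End.HasEigenvector (hessian mixedCubic 0).toLinearMap 2
      (EuclideanSpace.single 0 1) := by
    refine ⟨Module.End.mem_eigenspace_iff.2 ?_, by simp⟩
    change hessian mixedCubic 0 _ = _
    rw [hH, mixedCubicHessian_apply]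
    ext i; fin_cases i <;> simp
  refine ⟨?_, timesDifferentiableAt_mixedCubic 0, fun w hw => ?_, hvec, fun μ hμ => ?_, ?_,
    by norm_num⟩
  · have hc : ∀ᶠ y : EuclideanSpace ℝ (Fin 2) in 𝓝 0, -1 < y 1 := by
      have : Continuous fun y : EuclideanSpace ℝ (Fin 2) => y 1 := by fun_prop
      exact (this.tendsto 0).eventually_const_lt (by simp)
    filter_upwards [hc] with y hy
    have h1 : mixedCubic 0 = 0 := by simp [mixedCubic]
    have h2 : mixedCubic y = y 0 ^ 2 * (1 + y 1) + y 1 ^ 2 / 2 := by rw [mixedCubic]; ring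
    rw [h1, h2]
    have : 0 < 1 + y 1 := by linarith
    positivity
  · have h1 : inner ℝ w (hessian mixedCubic 0 w) = 2 * w 0 ^ 2 + w 1 ^ 2 := by
      rw [hH, mixedCubicHessian_apply]
      simp [PiLp.inner_apply, Fin.sum_univ_two]
      ring
    rw [h1]
    rcases eq_or_ne (w 0) 0 with h0 | h0
    · have h2 : w 1 ≠ 0 := fun h => hw (by ext i; fin_cases i <;> simp [h0, h])
      positivity
    · positivity
  · obtain ⟨w, hw⟩ := hμ.exists_hasEigenvector
    have h1 : hessian mixedCubic 0 w = μ • w := hw.apply_eq_smul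
    rw [hH, mixedCubicHessian_apply] at h1
    have h2 : 2 * w 0 = μ * w 0 := by simpa using congrArg (fun z => z 0) h1
    have h3 : w 1 = μ * w 1 := by simpa using congrArg (fun z => z 1) h1
    by_contra! hlt
    refine hw.2 (by ext i; fin_cases i <;> simp <;> nlinarith)
  · refine (finrank_eq_one_iff_of_nonzero' (⟨_, hvec.1⟩ : Module.End.eigenspace
      (hessian mixedCubic 0).toLinearMap 2) (fun h => hvec.2 (congrArg Subtype.val h))).2
      fun ⟨w, hw⟩ => ⟨w 0, Subtype.ext ?_⟩
    have h1 : hessian mixedCubic 0 w = (2 : ℝ) • w := Module.End.mem_eigenspace_iff.1 hw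
    rw [hH, mixedCubicHessian_apply] at h1
    have h3 : w 1 = 2 * w 1 := by simpa using congrArg (fun z => z 1) h1
    ext i; fin_cases i
    · simp
    · simp; linarith

end Example

/-! ### The condition in the sharpest direction is sufficient but not necessary -/

theorem mainTheorem2 :
    (∀ (d : ℕ) (L : EuclideanSpace ℝ (Fin d) → ℝ) (x v : EuclideanSpace ℝ (Fin d)) (lam ηc : ℝ),
      EdgeOfStability L x v lam ηc →
      (SharpDirectionCondition L x v ∨ derivForm 4 L x v < 0) →
      HasStableTwoCycleNear L x ηc) ∧
    (∃ (d : ℕ) (L : EuclideanSpace ℝ (Fin d) → ℝ) (x v : EuclideanSpace ℝ (Fin d)) (lam ηc : ℝ),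
      EdgeOfStability L x v lam ηc ∧ HasStableTwoCycleNear L x ηc ∧
      ¬ SharpDirectionCondition L x v) := by
  refine ⟨fun d L x v lam ηc h hcond => ?_, 2, mixedCubic, 0, EuclideanSpace.single 0 1, 2, 1,
    edgeOfStability_mixedCubic, ?_, ?_⟩
  · refine h.hasStableTwoCycleNear_of_sharpDirectionCondition (hcond.elim id fun hneg => ?_)
    obtain ⟨-, h1, h2, h3⟩ := h.differentiable.fderiv_four
    have hp : 0 ≤ derivForm 2 L x v := by
      rw [derivForm_two, ← (gradient_derivatives h1 h2 h3).2.1]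
      exact (h.hessian_pos v h.eigenvector.2).le
    exact hneg.trans_le (by positivity)
  all_goals
    obtain ⟨-, h1, h2, h3⟩ := (timesDifferentiableAt_mixedCubic 0).fderiv_four
    obtain ⟨-, -, k3, k4⟩ := gradient_derivatives h1 h2 h3
    have e4 : derivForm 4 mixedCubic 0 (EuclideanSpace.single 0 1) = 0 := by
      rw [derivForm_four, ← k4]
      change inner ℝ _ (fderiv ℝ (fderiv ℝ (hessian mixedCubic)) 0 _ _ _) = _
      simp [fderiv_hessian_mixedCubic]
  · refine edgeOfStability_mixedCubic.hasStableTwoCycleNear (u := EuclideanSpace.single 1 2) ?_ ?_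
    · rw [fderiv_hessian_mixedCubic, hessian_mixedCubic]
      ext i; fin_cases i <;> simp [mixedCubicHessian_apply, mixedCubicThird_apply]
    · rw [e4, fderiv_hessian_mixedCubic]
      simp [mixedCubicThird_apply, PiLp.inner_apply]
  · have e3 : derivForm 3 mixedCubic 0 (EuclideanSpace.single 0 1) = 0 := by
      rw [derivForm_three, ← k3]
      change inner ℝ _ (fderiv ℝ (hessian mixedCubic) 0 _ _) = _
      rw [fderiv_hessian_mixedCubic]
      simp [mixedCubicThird_apply, PiLp.inner_apply]
    simp [SharpDirectionCondition, e3, e4]
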